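/- Let $n\ge 0$ and let $m_1,\dots,m_n$ be positive integers; put $\delta=\sqrt{\sum_{i=1}^n m_i^2}$. \textbf{Rays.} Let $p_1,\dots,p_n$ be points of $\mathbb P^2$ over a field $K$, let $X_n$ be the blow-up of $\mathbb P^2$ at these points, with line class $L$ and exceptional divisors $E_1,\dots,E_n$, and write $(d;a_1,\dots,a_n)=dL-\sum a_iE_i$ in $N_1(X_n)=\mathrm{Pic}(X_n)\otimes\mathbb R\cong\mathbb R^{n+1}$, with intersection form $(d;a)\cdot(d';a')=dd'-\sum a_ia_i'$. An integral class $(d;a_1,\dots,a_n)$ is effective if $d\ge 0$ and there is a nonzero form of degree $d$ over $K$ with multiplicity at least $\max(a_i,0)$ at $p_i$ for all $i$. A class is nef if its intersection with every effective class is nonnegative. A ray is a set $[\xi]=\{\lambda\xi:\lambda>0\}$ with $\xi\neq 0$; it is nef if $\xi$ is, rational if it contains a class in $\mathrm{Pic}(X_n)\otimes\mathbb Q$, and effective if it contains an effective class. Let $\mathcal Q_n=\{\xi:\xi\cdot L\ge 0,\ \xi^2\ge 0\}$. A ray contained in $\partial\mathcal Q_n$ is good if it is rational and not effective, and wonderful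 if it is irrational (not rational) and nef. \textbf{Nagata's construction.} Let $F$ be a field, $\mathbf X=(x_{ij})_{1\le i\le 3,\,1\le j\le n}$ a matrix of indeterminates, $k=F(x_{ij})$, and $x_j=[x_{1j},x_{2j},x_{3j}]\in\mathbb P^2_k$. Let $V=\{\mathbf b\in k^n:\mathbf X\mathbf b^t=0\}$ and $H=\{\mathbf c\in(k^*)^n: c_1^{m_1}\cdots c_n^{m_n}=1\}$. Let $G$ be the set $H\times V$, whose elements $\sigma=(\mathbf c,\mathbf b)$ act on the polynomial ring $k[\mathbf u,\mathbf v]=k[u_1,\dots,u_n,v_1,\dots,v_n]$ by the $k$-algebra automorphisms $$\sigma(u_i)=\frac{c_i}{c}(u_i+b_iv_i),\qquad \sigma(v_i)=c_iv_i\qquad(1\le i\le n),\qquad c=c_1\cdots c_n,$$ and let $k[\mathbf u,\mathbf v]^G$ be the $k$-subalgebra of the polynomials fixed by all $\sigma\in G$. \textbf{Theorem.} (1) For every field $F$: if $(\delta;m_1,\dots,m_n)$ generates a good or a wonderful ray on the blow-up of $\mathbb P^2_k$ at the generic points $x_1,\dots,x_n$, then the $k$-algebra $k[\mathbf u,\mathbf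 v]^G$ is not finitely generated. (2) For $F=\mathbb C$: if $(\delta;m_1,\dots,m_n)$ generates a good or a wonderful ray on the blow-up of $\mathbb P^2_{\mathbb C}$ at $n$ very general points (that is, for all $n$-tuples of points whose homogeneous coordinates avoid the zero loci of some countable family of nonzero polynomials), then the $k$-algebra $k[\mathbf u,\mathbf v]^G$, with $k=\mathbb C(x_{ij})$, is not finitely generated. -/

import Mathlib

open MvPolynomial

noncomputable section

namespace NagataRays

/-! ### Linear systems of plane curves and rays on blow-ups of the plane

A point of the projective plane over `K` is given by homogeneous coordinates `a : Fin 3 → K`,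
and an `n`-tuple of points by `p : Fin n → Fin 3 → K`. -/

/-- The form `f` in three variables has multiplicity at least `r` at the point `a`: the Taylor
expansion of `f` at `a` has no terms of degree less than `r`.  (For a form `f` and `a ≠ 0`, the
multiplicity of the affine cone at `a` is that of the plane curve `f = 0` at the point `[a]`.) -/
def HasMultAtLeast {K : Type*} [Field K] (f : MvPolynomial (Fin 3) K) (a : Fin 3 → K) (r : ℕ) :
    Prop :=
  ∀ s : Fin 3 →₀ ℕ, s.degree < r →
    coeff s (aeval (fun i => X i + C (a i) : Fin 3 → MvPolynomial (Fin 3) K) f) = 0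

/-- The integral class `(d; a₁, …, aₙ) = dL - ∑ aᵢ Eᵢ` on the blow-up of the plane at the points
`p₁, …, pₙ` is effective: there is a nonzero form of degree `d` with multiplicity at least `aᵢ`
at `pᵢ`.  A negative `aᵢ` imposes no condition (`Eᵢ` is then a fixed component). -/
def EffectiveClass {K : Type*} [Field K] {n : ℕ} (p : Fin n → Fin 3 → K) (d : ℤ)
    (a : Fin n → ℤ) : Prop :=
  ∃ (e : ℕ) (f : MvPolynomial (Fin 3) K), (e : ℤ) = d ∧ f ≠ 0 ∧ f.IsHomogeneous e ∧
    ∀ j, HasMultAtLeast f (p j) (a j).toNat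

/-- `N₁(Xₙ) = Pic(Xₙ) ⊗ ℝ`, in coordinates with respect to the basis `(L, -E₁, …, -Eₙ)`. -/
abbrev N1 (n : ℕ) : Type := ℝ × (Fin n → ℝ)

/-- The intersection form: `L² = 1`, `Eᵢ² = -1`, all other products of basis elements vanish. -/
def inter {n : ℕ} (ξ η : N1 n) : ℝ := ξ.1 * η.1 - ∑ i, ξ.2 i * η.2 i

/-- The class in `N₁(Xₙ)` of an integral class. -/
def ofInt {n : ℕ} (d : ℤ) (a : Fin n → ℤ) : N1 n := ((d : ℝ), fun i => (a i : ℝ))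

/-- The class in `N₁(Xₙ)` of a rational class. -/
def ofRat {n : ℕ} (d : ℚ) (a : Fin n → ℚ) : N1 n := ((d : ℝ), fun i => (a i : ℝ))

/-- A class is nef if it has nonnegative intersection with every effective class. -/
def NefClass {K : Type*} [Field K] {n : ℕ} (p : Fin n → Fin 3 → K) (ξ : N1 n) : Prop :=
  ∀ (d : ℤ) (a : Fin n → ℤ), EffectiveClass p d a → 0 ≤ inter ξ (ofInt d a)

/-- The set `[ξ]` of positive multiples of `ξ`. -/
def ray {n : ℕ} (ξ : N1 n) : Set (N1 n) := {η | ∃ t : ℝ, 0 < t ∧ η = t • ξ}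

/-- A ray is a set `[ξ]` with `ξ ≠ 0`. -/
def IsRay {n : ℕ} (ρ : Set (N1 n)) : Prop := ∃ ξ : N1 n, ξ ≠ 0 ∧ ρ = ray ξ

/-- A ray is rational if it contains (equivalently, is generated by) a rational class. -/
def RationalRay {n : ℕ} (ρ : Set (N1 n)) : Prop := ∃ (d : ℚ) (a : Fin n → ℚ), ofRat d a ∈ ρ

/-- A ray is effective if it contains (equivalently, is generated by) an effective class. -/
def EffectiveRay {K : Type*} [Field K] {n : ℕ} (p : Fin n → Fin 3 → K) (ρ : Set (N1 n)) : Prop :=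
  ∃ (d : ℤ) (a : Fin n → ℤ), EffectiveClass p d a ∧ ofInt d a ∈ ρ

/-- The nonnegative cone: `ξ · L ≥ 0` and `ξ² ≥ 0`. -/
def nonnegCone (n : ℕ) : Set (N1 n) := {ξ | 0 ≤ inter ξ (ofInt 1 0) ∧ 0 ≤ inter ξ ξ}

/-- A good ray: a rational non-effective ray in the boundary of the nonnegative cone. -/
def IsGoodRay {K : Type*} [Field K] {n : ℕ} (p : Fin n → Fin 3 → K) (ρ : Set (N1 n)) : Prop :=
  IsRay ρ ∧ ρ ⊆ frontier (nonnegCone n) ∧ RationalRay ρ ∧ ¬ EffectiveRay p ρ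

/-- A wonderful ray: an irrational nef ray in the boundary of the nonnegative cone. -/
def IsWonderfulRay {K : Type*} [Field K] {n : ℕ} (p : Fin n → Fin 3 → K) (ρ : Set (N1 n)) :
    Prop :=
  IsRay ρ ∧ ρ ⊆ frontier (nonnegCone n) ∧ ¬ RationalRay ρ ∧ ∀ ξ ∈ ρ, NefClass p ξ

/-- The class `(δ; m₁, …, mₙ)` with `δ = √(∑ mᵢ²)`. -/
def deltaClass {n : ℕ} (m : Fin n → ℕ) : N1 n :=
  (Real.sqrt (∑ i, (m i : ℝ) ^ 2), fun i => (m i : ℝ))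

/-- `P` holds for `n` very general points of the complex projective plane: it holds outside the
zero loci of countably many nonzero polynomials in the homogeneous coordinates. -/
def ForVeryGeneral (n : ℕ) (P : (Fin n → Fin 3 → ℂ) → Prop) : Prop :=
  ∃ S : Set (MvPolynomial (Fin 3 × Fin n) ℂ), S.Countable ∧ (0 ∉ S) ∧
    ∀ p : Fin n → Fin 3 → ℂ, (∀ g ∈ S, eval (fun ij => p ij.2 ij.1) g ≠ 0) → P p

/-! ### Nagata's construction -/

/-- The field `k = F(x_{ij} : 1 ≤ i ≤ 3, 1 ≤ j ≤ n)`. -/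
abbrev GenericField (F : Type*) [Field F] (n : ℕ) : Type _ :=
  FractionRing (MvPolynomial (Fin 3 × Fin n) F)

/-- The matrix `(x_{ij})` of indeterminates, over `k`. -/
def genericMatrix (F : Type*) [Field F] (n : ℕ) : Matrix (Fin 3) (Fin n) (GenericField F n) :=
  Matrix.of fun i j =>
    algebraMap (MvPolynomial (Fin 3 × Fin n) F) (GenericField F n) (X (i, j))

/-- The points `xⱼ = [x_{1j}, x_{2j}, x_{3j}]` of the projective plane over `k`. -/
def genericPoints (F : Type*) [Field F] (n : ℕ) : Fin n → Fin 3 → GenericField F n :=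
  fun j i => genericMatrix F n i j

/-- The subspace `V` of `kⁿ` associated to the points: `b` with `(x_{ij}) b = 0`. -/
def subspaceV (F : Type*) [Field F] (n : ℕ) :
    Submodule (GenericField F n) (Fin n → GenericField F n) :=
  LinearMap.ker (Matrix.mulVecLin (genericMatrix F n))

/-- The subgroup `H` of `(k*)ⁿ`: those `c` with `c₁^{m₁} ⋯ cₙ^{mₙ} = 1`. -/
def subgroupH (F : Type*) [Field F] {n : ℕ} (m : Fin n → ℕ) :
    Subgroup (Fin n → (GenericField F n)ˣ) where
  carrier := {c | ∏ i, c i ^ m i = 1}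
  one_mem' := by simp
  mul_mem' := by
    intro a b ha hb
    simp only [Set.mem_ofPred_eq] at ha hb ⊢
    simp [mul_pow, Finset.prod_mul_distrib, ha, hb]
  inv_mem' := by
    intro a ha
    simp only [Set.mem_ofPred_eq] at ha ⊢
    simp [ha]

/-- The polynomial ring `k[u, v]`, with `uᵢ = X (Sum.inl i)` and `vᵢ = X (Sum.inr i)`. -/
abbrev PolyUV (F : Type*) [Field F] (n : ℕ) : Type _ :=
  MvPolynomial (Fin n ⊕ Fin n) (GenericField F n)

/-- The action of `σ = (c, b)`: with `c = c₁ ⋯ cₙ`,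
`σ(uᵢ) = (cᵢ / c) (uᵢ + bᵢ vᵢ)` and `σ(vᵢ) = cᵢ vᵢ`. -/
def sigma (F : Type*) [Field F] {n : ℕ} (c : Fin n → (GenericField F n)ˣ)
    (b : Fin n → GenericField F n) : PolyUV F n →ₐ[GenericField F n] PolyUV F n :=
  aeval (Sum.elim
    (fun i => C ((c i : GenericField F n) / ∏ j, (c j : GenericField F n)) *
      (X (Sum.inl i) + C (b i) * X (Sum.inr i)))
    (fun i => C (c i : GenericField F n) * X (Sum.inr i)))

/-- The invariant ring `A = k[u, v]^G`: the polynomials fixed by every `σ = (c, b)` with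
`c ∈ H` and `b ∈ V`. -/
def invariantRing (F : Type*) [Field F] {n : ℕ} (m : Fin n → ℕ) :
    Subalgebra (GenericField F n) (PolyUV F n) where
  carrier := {f | ∀ c ∈ subgroupH F m, ∀ b ∈ subspaceV F n, sigma F c b f = f}
  mul_mem' := by
    intro f g hf hg c hc b hb
    rw [map_mul, hf c hc b hb, hg c hc b hb]
  add_mem' := by
    intro f g hf hg c hc b hb
    rw [map_add, hf c hc b hb, hg c hc b hb]
  algebraMap_mem' := by
    intro r c _ b _
    exact AlgHom.commutes _ r

end NagataRays

end

open MvPolynomial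

noncomputable section

namespace NagataRays

/-! ### Multiplicities -/

section Multiplicity

variable {K : Type*} [Field K]

/-! Invariants are plane curves in disguise. Torus invariance forces every monomial of an invariant,
of degree `d` in `u`, to have degrees `cⱼ` in the pairs `uⱼ, vⱼ` with `d - cⱼ = t mⱼ` for a rational
`t` (`mul_eq_mul_of_mem_support`). Translation invariance makes the corresponding bihomogeneous
component descend along `u/v ↦ X (u/v)` to a curve of degree `d` with multiplicities at least `t mⱼ`
at the generic points (`effectiveClass_of_mem_support`). Conversely, such a curve evaluated at the
invariants `Yᵢ` is divisible by `∏ vⱼ^(t mⱼ)`, and the quotient is invariant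
(`exists_mem_invariantRing`).

A good or wonderful ray forces `d > δ t` strictly whenever `t > 0`
(`delta_mul_lt_of_effectiveClass`). The generators of a finitely generated ring have only finitely
many monomials, so a single `θ > δ` satisfies `d ≥ θ t` on all of them; as `d - θ t` is additive on
monomials, this passes to every invariant. A parameter count, however, yields curves with `d < θ t`
for each `θ > δ` (`exists_effectiveClass_lt`), a contradiction.

Very general complex points reduce to the generic ones because an effective class at the generic
points stays effective off a hypersurface, and by Baire some very general tuple avoids it. -/

theorem hasMultAtLeast_iff_mem {f : MvPolynomial (Fin 3) K} {a : Fin 3 → K} {r : ℕ} :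
    HasMultAtLeast f a r ↔
      aeval (fun i => X i + C (a i) : Fin 3 → MvPolynomial (Fin 3) K) f ∈
        idealOfVars (Fin 3) K ^ r :=
  (mem_pow_idealOfVars_iff' _ _).symm

theorem HasMultAtLeast.mono {f : MvPolynomial (Fin 3) K} {a : Fin 3 → K} {r s : ℕ}
    (h : HasMultAtLeast f a r) (hs : s ≤ r) : HasMultAtLeast f a s :=
  fun e he => h e (he.trans_le hs)

theorem hasMultAtLeast_zero (f : MvPolynomial (Fin 3) K) (a : Fin 3 → K) :
    HasMultAtLeast f a 0 :=
  fun _ he => absurd he (Nat.not_lt_zero _)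

theorem HasMultAtLeast.mul {f g : MvPolynomial (Fin 3) K} {a : Fin 3 → K} {r s : ℕ}
    (hf : HasMultAtLeast f a r) (hg : HasMultAtLeast g a s) : HasMultAtLeast (f * g) a (r + s) := by
  rw [hasMultAtLeast_iff_mem] at *
  rw [map_mul, pow_add]
  exact Ideal.mul_mem_mul hf hg

theorem HasMultAtLeast.pow {f : MvPolynomial (Fin 3) K} {a : Fin 3 → K} {r : ℕ}
    (hf : HasMultAtLeast f a r) (N : ℕ) : HasMultAtLeast (f ^ N) a (r * N) := by
  rw [hasMultAtLeast_iff_mem] at *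
  rw [map_pow, pow_mul]
  exact Ideal.pow_mem_pow hf N

theorem aeval_X_add_C_totalDegree_le {F : MvPolynomial (Fin 3) K} {d : ℕ}
    (hF : F.IsHomogeneous d) (a : Fin 3 → K) :
    (aeval (fun i => X i + C (a i) : Fin 3 → MvPolynomial (Fin 3) K) F).totalDegree ≤ d := by
  rw [aeval_def, eval₂_eq']
  refine totalDegree_finsetSum_le fun e he => ?_
  have hd : e.degree = d := (hF.degree_eq_sum_deg_support he).symm
  refine (totalDegree_mul _ _).trans ?_
  rw [algebraMap_eq, totalDegree_C, zero_add]
  refine (totalDegree_finsetProd _ _).trans ?_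
  rw [← hd, Finsupp.degree_eq_sum]
  refine Finset.sum_le_sum fun i _ => (totalDegree_pow _ _).trans ?_
  have : (X i + C (a i) : MvPolynomial (Fin 3) K).totalDegree ≤ 1 :=
    (totalDegree_add _ _).trans (by simp)
  nlinarith

/-- Rescaling the variables of a weighted homogeneous polynomial. -/
theorem aeval_pow_mul_of_isWeightedHomogeneous {σ R S : Type*} [Fintype σ] [CommSemiring R]
    [CommSemiring S] [Algebra R S] {w : σ → ℕ} {F : MvPolynomial σ R} {d : ℕ}
    (hF : IsWeightedHomogeneous w F d) (c : S) (g : σ → S) :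
    aeval (fun i => c ^ w i * g i) F = c ^ d * aeval g F := by
  simp only [aeval_def, eval₂_eq', Finset.mul_sum]
  refine Finset.sum_congr rfl fun e he => ?_
  have hd := hF (mem_support_iff.mp he)
  rw [Finsupp.weight_eq_sum] at hd
  simp only [mul_pow, Finset.prod_mul_distrib, ← pow_mul]
  rw [Finset.prod_pow_eq_pow_sum, ← hd]
  simp only [smul_eq_mul, mul_comm (w _)]
  ring

/-- The Taylor expansion of a form `F` at `a`, homogenized. -/
theorem aeval_smul_add_eq_sum {R : Type*} [CommRing R] [IsDomain R] [Algebra K R]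
    {F : MvPolynomial (Fin 3) K} {d : ℕ} (hF : F.IsHomogeneous d) (a : Fin 3 → K) {w : R}
    (hw : w ≠ 0) (z : Fin 3 → R) :
    aeval (fun i => a i • w + z i) F =
      ∑ e ∈ (aeval (fun i => X i + C (a i) : Fin 3 → MvPolynomial (Fin 3) K) F).support,
        coeff e (aeval (fun i => X i + C (a i) : Fin 3 → MvPolynomial (Fin 3) K) F) •
          (w ^ (d - e.degree) * ∏ i, z i ^ e i) := by
  set T := aeval (fun i => X i + C (a i) : Fin 3 → MvPolynomial (Fin 3) K) F with hT
  -- In the fraction field homogeneity gives `F(a w + z) = w^d F(a + z/w)`; the Taylor expansion on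
  -- the right has degree at most `d`, so no negative power of `w` remains.
  let ι : R →ₐ[K] FractionRing R := IsScalarTower.toAlgHom K R (FractionRing R)
  have hι : Function.Injective ι := IsFractionRing.injective R (FractionRing R)
  have hw' : ι w ≠ 0 := fun h => hw (hι (by rw [h, map_zero]))
  apply hι
  have h1 : ι (aeval (fun i => a i • w + z i) F) =
      aeval (fun i => ι w ^ (1 : Fin 3 → ℕ) i *
        (ι (z i) / ι w + algebraMap K (FractionRing R) (a i))) F := by
    rw [← AlgHom.comp_apply, comp_aeval]
    congr 2
    funext i
    rw [map_add, map_smul, Algebra.smul_def, Pi.one_apply, pow_one]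
    field_simp
    ring
  have h2 : aeval (fun i => ι (z i) / ι w + algebraMap K (FractionRing R) (a i)) F =
      aeval (fun i => ι (z i) / ι w) T := by
    rw [hT, ← AlgHom.comp_apply, comp_aeval]
    congr 2
    funext i
    simp
  rw [h1, aeval_pow_mul_of_isWeightedHomogeneous hF, h2, aeval_def, eval₂_eq', map_sum,
    Finset.mul_sum]
  refine Finset.sum_congr rfl fun e he => ?_
  have hle : e.degree ≤ d := (le_totalDegree he).trans (aeval_X_add_C_totalDegree_le hF a)
  have h3 : ι w ^ d = ι w ^ (d - e.degree) * ι w ^ e.degree := by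
    rw [← pow_add, Nat.sub_add_cancel hle]
  rw [map_smul, Algebra.smul_def, map_mul, map_prod, map_pow, h3]
  simp only [div_pow, Finset.prod_div_distrib, map_pow]
  rw [Finset.prod_pow_eq_pow_sum, ← Finsupp.degree_eq_sum]
  field_simp

/-- Each surviving Taylor term contains at least `r` factors `z i`. The alternative `z i = 0` lets
one direction be ignored. It serves both to test multiplicities and, with `I = (vⱼ)`, to extract
powers of `vⱼ`. -/
theorem aeval_smul_add_mem_pow {R : Type*} [CommRing R] [IsDomain R] [Algebra K R]
    {F : MvPolynomial (Fin 3) K} {d : ℕ} (hF : F.IsHomogeneous d) (a : Fin 3 → K) {w : R}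
    (hw : w ≠ 0) (z : Fin 3 → R) {I : Ideal R} (hz : ∀ i, z i ∈ I) {r : ℕ}
    (h : ∀ e : Fin 3 →₀ ℕ, e.degree < r →
      coeff e (aeval (fun i => X i + C (a i) : Fin 3 → MvPolynomial (Fin 3) K) F) = 0 ∨
        ∃ i, e i ≠ 0 ∧ z i = 0) :
    aeval (fun i => a i • w + z i) F ∈ I ^ r := by
  rw [aeval_smul_add_eq_sum hF a hw z]
  refine sum_mem fun e he => ?_
  by_cases hr : e.degree < r
  · rcases h e hr with h0 | ⟨i, hi, hzi⟩
    · rw [h0, zero_smul]; exact zero_mem _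
    · rw [Finset.prod_eq_zero (Finset.mem_univ i) (by rw [hzi, zero_pow hi]), mul_zero, smul_zero]
      exact zero_mem _
  · have hp : ∏ i, z i ^ e i ∈ I ^ e.degree := by
      rw [Finsupp.degree_eq_sum, ← Finset.prod_pow_eq_pow_sum]
      exact Ideal.prod_mem_prod fun i _ => Ideal.pow_mem_pow (hz i) _
    rw [Algebra.smul_def]
    exact Ideal.mul_mem_left _ _ (Ideal.mul_mem_left _ _ (Ideal.pow_le_pow_right (not_lt.mp hr) hp))

end Multiplicity

/-! ### Effective classes -/

section Effective

variable {K : Type*} [Field K] {n : ℕ} {p : Fin n → Fin 3 → K}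

theorem EffectiveClass.nonneg {d : ℤ} {a : Fin n → ℤ} (h : EffectiveClass p d a) : 0 ≤ d := by
  obtain ⟨e, -, rfl, -⟩ := h
  exact Int.natCast_nonneg e

/-- Multiples of an effective class, with a further multiple of the class of a line added. -/
theorem EffectiveClass.nsmul_add {d : ℤ} {a : Fin n → ℤ} (h : EffectiveClass p d a) (N s : ℕ) :
    EffectiveClass p (N * d + s) (fun j => N * a j) := by
  obtain ⟨e, f, rfl, hf0, hf, hm⟩ := h
  refine ⟨e * N + 1 * s, f ^ N * X 0 ^ s, by push_cast; ring, mul_ne_zero (pow_ne_zero _ hf0)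
    (pow_ne_zero _ (X_ne_zero _)), (hf.pow N).mul ((isHomogeneous_X K 0).pow s), fun j => ?_⟩
  refine (((hm j).pow N).mul (hasMultAtLeast_zero _ _)).mono ?_
  rcases le_total 0 (a j) with h0 | h0
  · zify
    rw [Int.toNat_of_nonneg (by positivity), Int.toNat_of_nonneg h0, add_zero, mul_comm]
  · rw [Int.toNat_of_nonpos (mul_nonpos_of_nonneg_of_nonpos (by positivity) h0)]
    exact Nat.zero_le _

/-- A linear form vanishing at all points is a curve of degree one with multiplicity at least one
at each of them. -/
theorem effectiveClass_of_vecMul_eq_zero {ℓ : Fin 3 → K} (hℓ : ℓ ≠ 0)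
    (h : ∀ j, ∑ i, ℓ i * p j i = 0) : EffectiveClass p 1 (fun _ => 1) := by
  refine ⟨1, ∑ i, C (ℓ i) * X i, rfl, ?_, ?_, fun j => ?_⟩
  · obtain ⟨i, hi⟩ := Function.ne_iff.mp hℓ
    intro h0
    apply hi
    have := congrArg (coeff (Finsupp.single i 1)) h0
    simpa [coeff_sum, coeff_C_mul, coeff_X, Finsupp.single_left_inj] using this
  · exact IsHomogeneous.sum _ _ _ fun i _ => isHomogeneous_C_mul_X _ _
  · rw [hasMultAtLeast_iff_mem]
    have : aeval (fun i => X i + C (p j i) : Fin 3 → MvPolynomial (Fin 3) K)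
        (∑ i, C (ℓ i) * X i) = ∑ i, C (ℓ i) * X i := by
      rw [map_sum]
      simp only [map_mul, aeval_X, aeval_C, algebraMap_eq, mul_add, Finset.sum_add_distrib]
      rw [add_eq_left]
      simp only [← C_mul, ← map_sum]
      rw [h j, C_0]
    rw [this, Int.toNat_one, pow_one]
    exact sum_mem fun i _ => Ideal.mul_mem_left _ _ (Ideal.subset_span ⟨i, rfl⟩)

end Effective

/-! ### Very general and generic points -/

/-- A nonempty open set contains a product of infinite sets, and a polynomial vanishing on such a
product is zero. -/
theorem dense_setOf_eval_ne_zero {σ : Type*} [Finite σ] {g : MvPolynomial σ ℂ} (hg : g ≠ 0) :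
    Dense {x : σ → ℂ | eval x g ≠ 0} := by
  intro x
  rw [mem_closure_iff]
  intro U hU hx
  by_contra hne
  apply hg
  have : Fintype σ := Fintype.ofFinite σ
  obtain ⟨u, hu, hsub⟩ := isOpen_pi_iff'.mp hU x hx
  refine funext_set u (fun i => infinite_of_mem_nhds (x i) ((hu i).1.mem_nhds (hu i).2))
    fun y hy => ?_
  by_contra hy0
  exact hne ⟨y, hsub hy, by simpa using hy0⟩

theorem exists_forall_eval_ne_zero {σ : Type*} [Finite σ] {S : Set (MvPolynomial σ ℂ)}
    (hS : S.Countable) (h0 : 0 ∉ S) : ∃ x : σ → ℂ, ∀ g ∈ S, eval x g ≠ 0 := by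
  have hd : Dense (⋂ g ∈ S, {x : σ → ℂ | eval x g ≠ 0}) :=
    dense_biInter_of_isOpen
      (fun g _ => isOpen_ne_fun (MvPolynomial.continuous_eval g) continuous_const) hS
      (fun g hg => dense_setOf_eval_ne_zero (fun h => h0 (h ▸ hg)))
  obtain ⟨x, hx⟩ := hd.nonempty
  exact ⟨x, fun g hg => by simpa using Set.mem_iInter₂.mp hx g hg⟩

theorem map_aeval_X_add_C {σ R S : Type*} [CommRing R] [CommRing S] (φ : R →+* S) (x : σ → R)
    (q : MvPolynomial σ R) :
    map φ (aeval (fun i => X i + C (x i) : σ → MvPolynomial σ R) q) =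
      aeval (fun i => X i + C (φ (x i)) : σ → MvPolynomial σ S) (map φ q) := by
  refine (map_bind₁ φ _ q).trans ?_
  simp only [map_add, map_X, map_C]
  rfl

/-- An effective class at the generic points is effective at the points outside of a
hypersurface. -/
theorem EffectiveClass.exists_specialization {F : Type*} [Field F] {n : ℕ} {d : ℤ}
    {a : Fin n → ℤ} (h : EffectiveClass (genericPoints F n) d a) :
    ∃ g : MvPolynomial (Fin 3 × Fin n) F, g ≠ 0 ∧ ∀ p : Fin n → Fin 3 → F,
      eval (fun ij => p ij.2 ij.1) g ≠ 0 → EffectiveClass p d a := by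
  obtain ⟨e, f, rfl, hf0, hf, hmult⟩ := h
  set B := MvPolynomial (Fin 3 × Fin n) F
  have hinj : Function.Injective (algebraMap B (GenericField F n)) :=
    IsFractionRing.injective B (GenericField F n)
  -- Clearing denominators gives a form over the polynomial ring. Homogeneity and multiplicity are
  -- vanishing conditions on coefficients and survive every specialization; only `f₀ ≠ 0` needs
  -- care, and one nonzero coefficient serves as the hypersurface.
  obtain ⟨b, hb⟩ := IsLocalization.exist_integer_multiples (nonZeroDivisors B) f.support
    (fun s => coeff s f)
  choose! c hc using hb
  let f₀ : MvPolynomial (Fin 3) B := ∑ s ∈ f.support, monomial s (c s)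
  have hb0 : algebraMap B (GenericField F n) b ≠ 0 := by
    intro h0
    exact nonZeroDivisors.coe_ne_zero b (hinj (by rw [h0, map_zero]))
  have hmap : map (algebraMap B (GenericField F n)) f₀ =
      C (algebraMap B (GenericField F n) b) * f := by
    conv_rhs => rw [f.as_sum, Finset.mul_sum]
    simp only [f₀, map_sum, map_monomial, C_mul_monomial]
    refine Finset.sum_congr rfl fun s hs => ?_
    rw [hc s hs, Algebra.smul_def]
  have hf₀ : f₀ ≠ 0 := by
    intro h0
    rw [h0, map_zero] at hmap
    exact (mul_ne_zero (by simp) hf0) hmap.symm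
  obtain ⟨s, hs⟩ := ne_zero_iff.mp hf₀
  refine ⟨coeff s f₀, hs, fun p hp => ?_⟩
  let ev : B →+* F := eval (fun ij => p ij.2 ij.1)
  refine ⟨e, map ev f₀, rfl, ?_, ?_, fun j t ht => ?_⟩
  · intro h0
    apply hp
    have := congrArg (coeff s) h0
    rwa [coeff_map, coeff_zero] at this
  · refine IsHomogeneous.map (IsHomogeneous.of_map hinj ?_) ev
    rw [hmap]
    exact hf.C_mul _
  · let x : Fin 3 → B := fun i => X (i, j)
    have h1 : coeff t (aeval (fun i => X i + C (x i) : Fin 3 → MvPolynomial (Fin 3) B) f₀) = 0 := by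
      apply hinj
      rw [← coeff_map, map_aeval_X_add_C, hmap, map_mul, map_zero]
      have h2 := hmult j t ht
      rw [aeval_C, algebraMap_eq, coeff_C_mul]
      refine mul_eq_zero_of_right _ ?_
      exact h2
    have h3 := congrArg ev h1
    rw [← coeff_map, map_aeval_X_add_C, map_zero] at h3
    have h4 : ∀ i, ev (x i) = p j i := fun i => eval_X _
    simpa only [h4] using h3

/-- Good and wonderful rays at very general points are so at the generic points. -/
theorem ForVeryGeneral.generic {n : ℕ} {ρ : Set (N1 n)}
    (h : ForVeryGeneral n (fun p => IsGoodRay p ρ ∨ IsWonderfulRay p ρ)) :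
    IsGoodRay (genericPoints ℂ n) ρ ∨ IsWonderfulRay (genericPoints ℂ n) ρ := by
  obtain ⟨S, hS, h0, hP⟩ := h
  have key : ∀ g : MvPolynomial (Fin 3 × Fin n) ℂ, g ≠ 0 → ∃ p : Fin n → Fin 3 → ℂ,
      eval (fun ij => p ij.2 ij.1) g ≠ 0 ∧ (IsGoodRay p ρ ∨ IsWonderfulRay p ρ) := by
    intro g hg
    obtain ⟨x, hx⟩ := exists_forall_eval_ne_zero (hS.insert g)
      (by rw [Set.mem_insert_iff, not_or]; exact ⟨hg.symm, h0⟩)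
    refine ⟨fun j i => x (i, j), hx g (Set.mem_insert _ _), hP _ fun g' hg' => ?_⟩
    exact hx g' (Set.mem_insert_of_mem _ hg')
  obtain ⟨p₀, -, hp₀⟩ := key 1 one_ne_zero
  -- Rationality of the ray does not involve the points, so the same alternative holds at all very
  -- general tuples.
  by_cases hρ : RationalRay ρ
  · have hp₀ : IsGoodRay p₀ ρ := hp₀.resolve_right fun h => h.2.2.1 hρ
    refine Or.inl ⟨hp₀.1, hp₀.2.1, hρ, ?_⟩
    rintro ⟨d, a, hda, hmem⟩
    obtain ⟨g, hg, hspec⟩ := hda.exists_specialization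
    obtain ⟨p, hp, hgood⟩ := key g hg
    exact (hgood.resolve_right fun h => h.2.2.1 hρ).2.2.2 ⟨d, a, hspec p hp, hmem⟩
  · have hp₀ : IsWonderfulRay p₀ ρ := hp₀.resolve_left fun h => hρ h.2.2.1
    refine Or.inr ⟨hp₀.1, hp₀.2.1, hρ, fun ξ hξ d a hda => ?_⟩
    obtain ⟨g, hg, hspec⟩ := hda.exists_specialization
    obtain ⟨p, hp, hw⟩ := key g hg
    exact (hw.resolve_left fun h => hρ h.2.2.1).2.2.2 ξ hξ d a (hspec p hp)

/-! ### Curves of low degree with prescribed multiplicities -/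

section Counting

theorem two_mul_card_sigma_fin (N : ℕ) :
    2 * Fintype.card (Σ i : Fin N, Fin (i + 1)) = N * (N + 1) := by
  simp only [Fintype.card_sigma, Fintype.card_fin]
  rw [Fin.sum_univ_eq_sum_range (fun i => i + 1) N]
  induction N with
  | zero => simp
  | succ N ih => rw [Finset.sum_range_succ, mul_add, ih]; ring

/-- The exponent `(s, q, i - q)`. -/
def exponent (s : ℕ) {N : ℕ} (x : Σ i : Fin N, Fin (i + 1)) : Fin 3 →₀ ℕ :=
  Finsupp.equivFunOnFinite.symm ![s, x.2, x.1 - x.2]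

theorem exponent_degree (s : ℕ) {N : ℕ} (x : Σ i : Fin N, Fin (i + 1)) :
    (exponent s x).degree = s + x.1 := by
  have := x.2.isLt
  simp only [exponent, Finsupp.degree_eq_sum, Fin.sum_univ_three,
    Finsupp.equivFunOnFinite_symm_apply_apply, Matrix.cons_val_zero, Matrix.cons_val_one,
    Matrix.cons_val]
  omega

/-- The last two entries already determine `x`. The first entries may differ, since in degree `e`
the first entry `e - i` depends on `x`. -/
theorem exponent_injective {N : ℕ} (s t : ℕ) {x y : Σ i : Fin N, Fin (i + 1)}
    (h : exponent s x = exponent t y) : x = y := by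
  have h1 := DFunLike.congr_fun h 1
  have h2 := DFunLike.congr_fun h 2
  obtain ⟨i, q⟩ := x
  obtain ⟨i', q'⟩ := y
  have hq := q.isLt
  have hq' := q'.isLt
  simp only [exponent, Finsupp.equivFunOnFinite_symm_apply_apply, Matrix.cons_val_one,
    Matrix.cons_val] at h1 h2
  obtain rfl : i = i' := Fin.ext (by omega)
  obtain rfl : q = q' := Fin.ext h1
  rfl

variable {K : Type*} [Field K] {n : ℕ}

/-- For a form, the terms of the Taylor expansion at `a` in two directions complementary to `a`
decide about the multiplicity. -/
theorem hasMultAtLeast_of_coeff {F : MvPolynomial (Fin 3) K} {d r : ℕ} (hF : F.IsHomogeneous d)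
    {a : Fin 3 → K} (ha : a 0 ≠ 0)
    (h : ∀ e : Fin 3 →₀ ℕ, e.degree < r → e 0 = 0 →
      coeff e (aeval (fun i => X i + C (a i) : Fin 3 → MvPolynomial (Fin 3) K) F) = 0) :
    HasMultAtLeast F a r := by
  rw [hasMultAtLeast_iff_mem]
  -- Chosen so that `X + a = a w + z` with `z 0 = 0`: Taylor terms involving direction `0` then drop
  -- out.
  let w : MvPolynomial (Fin 3) K := 1 + C (a 0)⁻¹ * X 0
  let z : Fin 3 → MvPolynomial (Fin 3) K := fun i => X i - C (a i * (a 0)⁻¹) * X 0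
  have hw : w ≠ 0 := by
    intro h0
    have := congrArg (coeff 0) h0
    simp [w] at this
  have hX : ∀ i, (X i : MvPolynomial (Fin 3) K) ∈ idealOfVars (Fin 3) K :=
    fun i => Ideal.subset_span ⟨i, rfl⟩
  have hz : ∀ i, z i ∈ idealOfVars (Fin 3) K :=
    fun i => sub_mem (hX i) (Ideal.mul_mem_left _ _ (hX 0))
  have hmem := aeval_smul_add_mem_pow hF a hw z hz (r := r) fun e he => ?_
  · have hwz : ∀ i, a i • w + z i = X i + C (a i) := fun i => by
      simp only [w, z, smul_eq_C_mul, C_mul]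
      ring
    simpa only [hwz] using hmem
  · by_cases h0 : e 0 = 0
    · exact Or.inl (h e he h0)
    · refine Or.inr ⟨0, h0, ?_⟩
      simp only [z, mul_inv_cancel₀ ha, C_1, one_mul, sub_self]

/-- Linear algebra: a form of degree `e` has `(e+1)(e+2)/2` coefficients, and multiplicity `r` costs
only `r(r+1)/2` conditions, because `hasMultAtLeast_of_coeff` reduces the test to exponents with `e
0 = 0`. -/
theorem effectiveClass_of_sum_lt {p : Fin n → Fin 3 → K} (hp : ∀ j, p j 0 ≠ 0) {e : ℕ}
    {r : Fin n → ℕ} (h : ∑ j, r j * (r j + 1) < (e + 1) * (e + 2)) :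
    EffectiveClass p e (fun j => r j) := by
  let D := Σ i : Fin (e + 1), Fin (i + 1)
  let E := Σ j : Fin n, Σ i : Fin (r j), Fin (i + 1)
  let mon : D → MvPolynomial (Fin 3) K := fun x => monomial (exponent (e - x.1) x) 1
  let Φ : (D → K) →ₗ[K] MvPolynomial (Fin 3) K := Fintype.linearCombination K mon
  have hΦ : ∀ c, Φ c = ∑ x, c x • mon x := fun c => Fintype.linearCombination_apply K mon c
  let Ψ : MvPolynomial (Fin 3) K →ₗ[K] (E → K) := LinearMap.pi fun y =>
    (lcoeff K (exponent 0 y.2)).comp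
      (aeval (fun i => X i + C (p y.1 i) : Fin 3 → MvPolynomial (Fin 3) K)).toLinearMap
  have hcard : Fintype.card E < Fintype.card D := by
    have h1 : 2 * Fintype.card E = ∑ j, r j * (r j + 1) := by
      rw [Fintype.card_sigma, Finset.mul_sum]
      exact Finset.sum_congr rfl fun j _ => two_mul_card_sigma_fin _
    have h2 : 2 * Fintype.card D = (e + 1) * (e + 2) := two_mul_card_sigma_fin (e + 1)
    omega
  have hker : LinearMap.ker (Ψ.comp Φ) ≠ ⊥ :=
    LinearMap.ker_ne_bot_of_finrank_lt (by simpa using hcard)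
  obtain ⟨c, hc, hc0⟩ := (Submodule.ne_bot_iff _).mp hker
  have hom : (Φ c).IsHomogeneous e := by
    rw [hΦ]
    refine IsHomogeneous.sum _ _ _ fun x _ => ?_
    rw [smul_eq_C_mul]
    refine (isHomogeneous_monomial _ ?_).C_mul _
    rw [exponent_degree]
    have := x.1.isLt
    omega
  refine ⟨e, Φ c, rfl, ?_, hom, fun j => ?_⟩
  · obtain ⟨x, hx⟩ := Function.ne_iff.mp hc0
    intro h0
    apply hx
    have h1 := congrArg (coeff (exponent (e - x.1) x)) h0
    rw [hΦ, coeff_sum, Finset.sum_eq_single x] at h1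
    · simpa [mon] using h1
    · intro y _ hy
      have : exponent (e - y.1) y ≠ exponent (e - x.1) x := fun h => hy (exponent_injective _ _ h)
      simp [mon, coeff_monomial, this]
    · exact fun h => absurd (Finset.mem_univ x) h
  · rw [Int.toNat_natCast]
    refine hasMultAtLeast_of_coeff hom (hp j) fun s hs hs0 => ?_
    rw [Finsupp.degree_eq_sum, Fin.sum_univ_three, hs0, zero_add] at hs
    let y : E := ⟨j, ⟨s 1 + s 2, hs⟩, ⟨s 1, by simp⟩⟩
    have hy : exponent 0 y.2 = s := by
      ext i
      fin_cases i <;> simp [exponent, y, hs0]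
    have := congrFun (LinearMap.mem_ker.mp hc) y
    simpa [Ψ, hy] using this

/-- There are effective multiples of `(θ; m₁, …, mₙ)` from below, for all `θ > δ`. -/
theorem exists_effectiveClass_lt {p : Fin n → Fin 3 → K} (hp : ∀ j, p j 0 ≠ 0) (m : Fin n → ℕ)
    {θ : ℝ} (hθ : (deltaClass m).1 < θ) :
    ∃ t e : ℕ, 0 < t ∧ (e : ℝ) < θ * t ∧ EffectiveClass p e (fun j => ((t * m j : ℕ) : ℤ)) := by
  set δ := (deltaClass m).1 with hδ
  have hδ0 : 0 ≤ δ := Real.sqrt_nonneg _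
  have hδ2 : δ ^ 2 = ∑ i, (m i : ℝ) ^ 2 := Real.sq_sqrt (by positivity)
  set M : ℝ := ∑ i, (m i : ℝ) with hM
  have hM0 : 0 ≤ M := by positivity
  set ε := (θ - δ) / 2 with hε
  have hε0 : 0 < ε := by rw [hε]; linarith
  -- `t > 1/ε` leaves room to round `(δ + ε) t` up below `θ t`; `t > M/ε²` makes `ε² t²` absorb the
  -- linear term `t M` of the count.
  obtain ⟨t, ht⟩ := exists_nat_gt (max (1 / ε) (M / ε ^ 2))
  have ht1 : 1 < t * ε := by
    rw [← div_lt_iff₀ hε0]; exact (le_max_left _ _).trans_lt ht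
  have ht2 : M < t * ε ^ 2 := by
    rw [← div_lt_iff₀ (by positivity)]; exact (le_max_right _ _).trans_lt ht
  have ht0 : (0 : ℝ) < t := by
    by_contra h0
    nlinarith
  let e := ⌈(δ + ε) * t⌉₊
  have he1 : (δ + ε) * t ≤ e := Nat.le_ceil _
  have he2 : (e : ℝ) < (δ + ε) * t + 1 := Nat.ceil_lt_add_one (by positivity)
  refine ⟨t, e, by exact_mod_cast ht0, ?_, effectiveClass_of_sum_lt hp ?_⟩
  · have : θ = δ + ε + ε := by rw [hε]; ring
    rw [this]
    linarith
  · rw [← Nat.cast_lt (α := ℝ)]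
    push_cast
    have h1 : ∑ j, (t * m j : ℝ) * (t * m j + 1) = t ^ 2 * δ ^ 2 + t * M := by
      rw [hδ2, hM, Finset.mul_sum, Finset.mul_sum, ← Finset.sum_add_distrib]
      exact Finset.sum_congr rfl fun j _ => by ring
    rw [h1]
    have h2 : ((δ + ε) * t) ^ 2 ≤ (e : ℝ) ^ 2 := by gcongr
    have h3 : t * M < t * (t * ε ^ 2) := by gcongr
    have h4 : 0 ≤ δ * ε * t ^ 2 := by positivity
    nlinarith

end Counting

/-! ### Good and wonderful rays -/

section Rays

variable {K : Type*} [Field K] {n : ℕ} {p : Fin n → Fin 3 → K} {m : Fin n → ℕ}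

theorem mem_ray_deltaClass {d : ℤ} {a : Fin n → ℤ} {t : ℝ} (ht : 0 < t)
    (hd : (d : ℝ) = t * (deltaClass m).1) (ha : ∀ j, (a j : ℝ) = t * m j) :
    ofInt d a ∈ ray (deltaClass m) :=
  ⟨t, ht, Prod.ext hd (funext ha)⟩

theorem rationalRay_deltaClass_iff (hm : ∀ i, 0 < m i) :
    RationalRay (ray (deltaClass m)) ↔
      ∃ x y : ℕ, 0 < y ∧ (x : ℝ) = y * (deltaClass m).1 := by
  constructor
  · rintro ⟨q, b, t, ht, h⟩
    rcases Nat.eq_zero_or_pos n with rfl | hn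
    · exact ⟨0, 1, one_pos, by simp [deltaClass]⟩
    have h1 : (q : ℝ) = t * (deltaClass m).1 := congrArg Prod.fst h
    have h2 : (b ⟨0, hn⟩ : ℝ) = t * m ⟨0, hn⟩ := congrFun (congrArg Prod.snd h) ⟨0, hn⟩
    set j : Fin n := ⟨0, hn⟩
    have hmj : (0 : ℝ) < m j := by exact_mod_cast hm j
    have hb : (0 : ℝ) < b j := by rw [h2]; positivity
    have hδ : ((q * m j / b j : ℚ) : ℝ) = (deltaClass m).1 := by
      push_cast
      rw [h1, h2]
      field_simp
    set r : ℚ := q * m j / b j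
    have hr : 0 ≤ r := by
      have : (0 : ℝ) ≤ r := by rw [hδ]; exact Real.sqrt_nonneg _
      exact_mod_cast this
    refine ⟨r.num.toNat, r.den, r.den_pos, ?_⟩
    rw [← hδ]
    have h3 : ((r.num.toNat : ℕ) : ℚ) = r.den * r := by
      rw [mul_comm, Rat.mul_den_eq_num]
      exact_mod_cast Int.toNat_of_nonneg (Rat.num_nonneg.mpr hr)
    exact_mod_cast h3
  · rintro ⟨x, y, hy, h⟩
    refine ⟨x, fun j => y * m j, y, by exact_mod_cast hy, Prod.ext ?_ (funext fun j => ?_)⟩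
    · simpa [ofRat] using h
    · simp [ofRat, deltaClass]

theorem deltaClass_sq (m : Fin n → ℕ) : (deltaClass m).1 ^ 2 = ∑ i, (m i : ℝ) ^ 2 :=
  Real.sq_sqrt (by positivity)

/-- On a good or wonderful ray, effective classes proportional to `m` have degree larger than the
one predicted by `δ`. -/
theorem delta_mul_lt_of_effectiveClass (hm : ∀ i, 0 < m i)
    (h : IsGoodRay p (ray (deltaClass m)) ∨ IsWonderfulRay p (ray (deltaClass m)))
    {d : ℤ} {a : Fin n → ℤ} (hda : EffectiveClass p d a) {N A : ℕ} (hN : 0 < N) (hA : 0 < A)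
    (ha : ∀ j, (N : ℤ) * a j = A * m j) : (deltaClass m).1 * A < N * d := by
  have haR : ∀ j, (N : ℝ) * a j = A * m j := fun j => by exact_mod_cast ha j
  have hNR : (0 : ℝ) < N := by exact_mod_cast hN
  have hAR : (0 : ℝ) < A := by exact_mod_cast hA
  set δ := (deltaClass m).1 with hδ
  by_contra hlt
  rw [not_lt] at hlt
  rcases h with ⟨-, -, hrat, heff⟩ | ⟨hray, -, hrat, hnef⟩
  -- Good case: with `δ = x/y`, padding `y N` copies of the class by `s` lines gives `(A x; y A m)`,
  -- which lies on the ray.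
  · obtain ⟨x, y, hy, hxy⟩ := (rationalRay_deltaClass_iff hm).mp hrat
    have hyR : (0 : ℝ) < y := by exact_mod_cast hy
    have hle : (y : ℤ) * N * d ≤ A * x := by
      have : (y : ℝ) * N * d ≤ A * x := by rw [hxy]; nlinarith
      exact_mod_cast this
    obtain ⟨s, hs⟩ := Int.eq_ofNat_of_zero_le (sub_nonneg.mpr hle)
    refine heff ⟨_, _, hda.nsmul_add (y * N) s,
      mem_ray_deltaClass (t := y * A) (by positivity) ?_ ?_⟩
    · rw [← hs]
      push_cast
      rw [hxy]
      ring
    · intro j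
      push_cast
      rw [mul_assoc, haR j]
      ring
  -- Wonderful case: nefness gives the reverse inequality unless `δ = 0`, so `δ = N d / A` would be
  -- rational.
  · have h0 := hnef (deltaClass m) ⟨1, one_pos, by rw [one_smul]⟩ d a hda
    have h1 : (N : ℝ) * inter (deltaClass m) (ofInt d a) = δ * (N * d) - A * δ ^ 2 := by
      rw [hδ, deltaClass_sq]
      simp only [inter, ofInt, mul_sub, Finset.mul_sum]
      congr 1
      · ring
      · refine Finset.sum_congr rfl fun j _ => ?_
        simp only [deltaClass]
        linear_combination (m j : ℝ) * haR j
    have h2 : 0 ≤ δ * (N * d) - A * δ ^ 2 := by rw [← h1]; positivity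
    have hδ0 : 0 ≤ δ := Real.sqrt_nonneg _
    apply hrat
    rw [rationalRay_deltaClass_iff hm]
    rcases hδ0.eq_or_lt with h3 | h3
    · exact ⟨0, 1, one_pos, by rw [← hδ, ← h3]; simp⟩
    · obtain ⟨D, rfl⟩ := Int.eq_ofNat_of_zero_le hda.nonneg
      refine ⟨N * D, A, hA, ?_⟩
      rw [← hδ]
      push_cast at hlt h2 ⊢
      refine le_antisymm (by linarith) ?_
      by_contra h4
      rw [not_le] at h4
      nlinarith

/-- This guarantees that the points span the plane. In the good case, `x = y δ ≥ y mⱼ` makes the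
`x`-fold line represent `(x; y m)` on the ray. In the wonderful case, nefness against the line gives
`δ ≥ ∑ mᵢ ≥ δ`, so `δ` is an integer. -/
theorem not_good_or_wonderful_of_line (hm : ∀ i, 0 < m i)
    (h : IsGoodRay p (ray (deltaClass m)) ∨ IsWonderfulRay p (ray (deltaClass m))) :
    ¬ EffectiveClass p 1 (fun _ => 1) := by
  intro hℓ
  rcases h with ⟨-, -, hrat, heff⟩ | ⟨-, -, hrat, hnef⟩
  · obtain ⟨x, y, hy, hxy⟩ := (rationalRay_deltaClass_iff hm).mp hrat
    obtain ⟨e, f, he, hf0, hf, hmult⟩ := hℓ.nsmul_add x 0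
    refine heff ⟨x, fun j => y * m j, ⟨e, f, by simpa using he, hf0, hf,
        fun j => (hmult j).mono ?_⟩,
      mem_ray_deltaClass (t := y) (by exact_mod_cast hy) (by exact_mod_cast hxy)
      fun j => by push_cast; rfl⟩
    have h1 : (m j : ℝ) ≤ (deltaClass m).1 := by
      refine Real.le_sqrt_of_sq_le ?_
      exact Finset.single_le_sum (f := fun i => (m i : ℝ) ^ 2) (fun i _ => by positivity)
        (Finset.mem_univ j)
    have h2 : y * m j ≤ x := by
      have : (y : ℝ) * m j ≤ x := by rw [hxy]; gcongr
      exact_mod_cast this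
    refine Int.toNat_le_toNat ?_
    simpa using (by exact_mod_cast h2 : (y : ℤ) * m j ≤ x)
  · have h0 := hnef (deltaClass m) ⟨1, one_pos, by rw [one_smul]⟩ _ _ hℓ
    apply hrat
    rw [rationalRay_deltaClass_iff hm]
    refine ⟨∑ i, m i, 1, one_pos, ?_⟩
    rw [Nat.cast_one, one_mul]
    refine le_antisymm ?_ ?_
    · push_cast
      simpa [inter, ofInt, deltaClass] using h0
    · refine Real.sqrt_le_iff.mpr ⟨by positivity, ?_⟩
      push_cast
      exact Finset.sum_sq_le_sq_sum_of_nonneg fun i _ => by positivity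

end Rays

/-! ### Weighted homogeneous components and substitutions -/

section Weighted

theorem aeval_isWeightedHomogeneous {σ τ R M : Type*} [Fintype σ] [CommSemiring R]
    [AddCommMonoid M] {w : σ → M} {w' : τ → M} {φ : MvPolynomial σ R} {d : M}
    (hφ : IsWeightedHomogeneous w φ d) {h : σ → MvPolynomial τ R}
    (hh : ∀ x, IsWeightedHomogeneous w' (h x) (w x)) :
    IsWeightedHomogeneous w' (aeval h φ) d := by
  rw [aeval_def, eval₂_eq']
  refine IsWeightedHomogeneous.sum _ _ _ fun e he => ?_
  rw [algebraMap_eq]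
  refine IsWeightedHomogeneous.C_mul ?_ _
  have hd := hφ (mem_support_iff.mp he)
  rw [Finsupp.weight_eq_sum] at hd
  rw [← hd]
  exact IsWeightedHomogeneous.prod _ _ _ fun x _ => (hh x).pow _

theorem eval_aeval {σ τ R : Type*} [CommSemiring R] (y : τ → R) (h : σ → MvPolynomial τ R)
    (g : MvPolynomial σ R) : eval y (aeval h g) = eval (fun x => eval y (h x)) g := by
  simp only [← coe_aeval_eq_eval]
  exact DFunLike.congr_fun (comp_aeval h (aeval y)) g

theorem polynomial_eval_aeval {σ R : Type*} [CommSemiring R] (c : R) (h : σ → Polynomial R)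
    (g : MvPolynomial σ R) :
    Polynomial.eval c (aeval h g) = eval (fun x => Polynomial.eval c (h x)) g := by
  simp only [← coe_aeval_eq_eval, ← Polynomial.coe_aeval_eq_eval]
  exact DFunLike.congr_fun (comp_aeval h (Polynomial.aeval c)) g

/-- Rescaling by powers of an auxiliary variable separates the weighted components as coefficients.
-/
theorem coeff_aeval_C_mul_X_pow {σ R : Type*} [Fintype σ] [CommSemiring R] (w : σ → ℕ)
    (p : σ → R) (d : ℕ) (f : MvPolynomial σ R) :
    (aeval (fun x => Polynomial.C (p x) * Polynomial.X ^ w x) f : Polynomial R).coeff d =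
      eval p (weightedHomogeneousComponent w d f) := by
  classical
  induction f using MvPolynomial.induction_on' with
  | monomial s a =>
    have h1 : (aeval (fun x => Polynomial.C (p x) * Polynomial.X ^ w x) (monomial s a) :
        Polynomial R) = Polynomial.C (a * ∏ x, p x ^ s x) * Polynomial.X ^ Finsupp.weight w s := by
      rw [aeval_monomial, Finsupp.prod_fintype _ _ (fun _ => pow_zero _)]
      simp only [mul_pow, Finset.prod_mul_distrib, ← pow_mul, Polynomial.C_mul, map_prod,
        Polynomial.C_pow]
      rw [Finset.prod_pow_eq_pow_sum, Finsupp.weight_eq_sum, mul_assoc]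
      simp only [smul_eq_mul, mul_comm (w _)]
      rfl
    rw [h1, Polynomial.coeff_C_mul, Polynomial.coeff_X_pow]
    by_cases hd : Finsupp.weight w s = d
    · rw [weightedHomogeneousComponent_eq_self (isWeightedHomogeneous_monomial w s a hd),
        eval_monomial, Finsupp.prod_fintype _ _ (fun _ => pow_zero _), if_pos hd.symm, mul_one]
    · rw [(isWeightedHomogeneous_monomial w s a rfl).weightedHomogeneousComponent_ne _
        (Ne.symm hd), if_neg (Ne.symm hd), mul_zero, map_zero]
  | add f g hf hg => rw [map_add, Polynomial.coeff_add, hf, hg, map_add, map_add]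

/-- If two points cannot be separated by `f` after any weighted rescaling, then they are not
separated by the weighted homogeneous components of `f`. -/
theorem eval_weightedHomogeneousComponent_congr {σ K : Type*} [Fintype σ] [Field K] [Infinite K]
    {w : σ → ℕ} {f : MvPolynomial σ K} {p q : σ → K}
    (h : ∀ c : K, c ≠ 0 → eval (fun x => p x * c ^ w x) f = eval (fun x => q x * c ^ w x) f)
    (d : ℕ) :
    eval p (weightedHomogeneousComponent w d f) = eval q (weightedHomogeneousComponent w d f) := by
  rw [← coeff_aeval_C_mul_X_pow, ← coeff_aeval_C_mul_X_pow]
  congr 1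
  refine Polynomial.eq_of_infinite_eval_eq _ _
    ((Set.finite_singleton (0 : K)).infinite_compl.mono ?_)
  intro c hc
  simpa [polynomial_eval_aeval] using h c hc

theorem coeff_aeval_C_mul_X {σ R : Type*} [Fintype σ] [CommSemiring R] (χ : σ → R)
    (f : MvPolynomial σ R) (μ : σ →₀ ℕ) :
    coeff μ (aeval (fun x => C (χ x) * X x : σ → MvPolynomial σ R) f) =
      (∏ x, χ x ^ μ x) * coeff μ f := by
  classical
  induction f using MvPolynomial.induction_on' with
  | monomial s a =>
    have h1 : aeval (fun x => C (χ x) * X x : σ → MvPolynomial σ R) (monomial s a) =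
        monomial s ((∏ x, χ x ^ s x) * a) := by
      rw [aeval_monomial, Finsupp.prod_fintype _ _ (fun _ => pow_zero _), algebraMap_eq]
      simp only [mul_pow, Finset.prod_mul_distrib, ← C_pow, ← map_prod]
      rw [monomial_eq (a := _ * a), Finsupp.prod_fintype _ _ (fun _ => pow_zero _), C_mul]
      ring
    rw [h1, coeff_monomial, coeff_monomial]
    split_ifs with hs
    · rw [hs]
    · rw [mul_zero]
  | add f g hf hg => rw [map_add, coeff_add, hf, hg, coeff_add, mul_add]

end Weighted

/-! ### From invariants to plane curves -/

section Curves

variable {K : Type*} [Field K] {n : ℕ}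

/-- Invariance under the translations `u ↦ u + v b`, for `b` in the kernel of `A`. -/
def TranslationInvariant (A : Matrix (Fin 3) (Fin n) K) (g : MvPolynomial (Fin n ⊕ Fin n) K) :
    Prop :=
  ∀ u v b : Fin n → K, A.mulVec b = 0 →
    eval (Sum.elim (u + v * b) v) g = eval (Sum.elim u v) g

/-- The weight counting the variables `u`. -/
def uWeight (n : ℕ) : Fin n ⊕ Fin n → ℕ := Sum.elim (fun _ => 1) (fun _ => 0)

/-- The weight counting the variables `v`. -/
def vWeight (n : ℕ) : Fin n ⊕ Fin n → ℕ := Sum.elim (fun _ => 0) (fun _ => 1)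

theorem weight_uWeight (μ : Fin n ⊕ Fin n →₀ ℕ) :
    Finsupp.weight (uWeight n) μ = ∑ i, μ (Sum.inl i) := by
  simp [Finsupp.weight_eq_sum, uWeight]

theorem weight_vWeight (μ : Fin n ⊕ Fin n →₀ ℕ) :
    Finsupp.weight (vWeight n) μ = ∑ i, μ (Sum.inr i) := by
  simp [Finsupp.weight_eq_sum, vWeight]

/-- Scaling `u` by `c` turns the translation by `b` into that by `c b`, again in the kernel; scaling
`v` works likewise with `c⁻¹ b`. -/
theorem TranslationInvariant.uComponent [Infinite K] {A : Matrix (Fin 3) (Fin n) K}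
    {g : MvPolynomial (Fin n ⊕ Fin n) K} (hg : TranslationInvariant A g) (d : ℕ) :
    TranslationInvariant A (weightedHomogeneousComponent (uWeight n) d g) := by
  intro u v b hb
  refine eval_weightedHomogeneousComponent_congr (fun c _ => ?_) d
  refine (congrArg (fun z => eval z g) (funext fun x => ?_)).trans
    ((hg (c • u) v (c • b) (by rw [Matrix.mulVec_smul, hb, smul_zero])).trans
      (congrArg (fun z => eval z g) (funext fun x => ?_)))
  · rcases x with i | i
    · simp [uWeight]; ring
    · simp [uWeight]
  · rcases x with i | i
    · simp [uWeight]; ring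
    · simp [uWeight]

theorem TranslationInvariant.vComponent [Infinite K] {A : Matrix (Fin 3) (Fin n) K}
    {g : MvPolynomial (Fin n ⊕ Fin n) K} (hg : TranslationInvariant A g) (d : ℕ) :
    TranslationInvariant A (weightedHomogeneousComponent (vWeight n) d g) := by
  intro u v b hb
  refine eval_weightedHomogeneousComponent_congr (fun c hc => ?_) d
  refine (congrArg (fun z => eval z g) (funext fun x => ?_)).trans
    ((hg u (c • v) (c⁻¹ • b) (by rw [Matrix.mulVec_smul, hb, smul_zero])).trans
      (congrArg (fun z => eval z g) (funext fun x => ?_)))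
  · rcases x with i | i
    · simp [vWeight]; field_simp
    · simp [vWeight]; ring
  · rcases x with i | i
    · simp [vWeight]
    · simp [vWeight]; ring

variable [Infinite K] {p : Fin n → Fin 3 → K} {Z : Matrix (Fin n) (Fin 3) K}

/-- A translation invariant polynomial that is homogeneous in `u` and homogeneous in each pair of
variables `uⱼ, vⱼ` gives rise to a plane curve with high multiplicities. -/
theorem TranslationInvariant.effectiveClass (hZ : (Matrix.of p).transpose * Z = 1)
    {g : MvPolynomial (Fin n ⊕ Fin n) K} (hg : TranslationInvariant (Matrix.of p).transpose g)
    (hg0 : g ≠ 0) {d : ℕ} (hd : IsWeightedHomogeneous (uWeight n) g d) {c : Fin n → ℕ}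
    (hc : ∀ μ ∈ g.support, ∀ j, μ (Sum.inl j) + μ (Sum.inr j) = c j) :
    EffectiveClass p d (fun j => d - c j) := by
  set A := (Matrix.of p).transpose with hA
  let h : Fin n ⊕ Fin n → MvPolynomial (Fin 3) K :=
    Sum.elim (fun j => ∑ i, C (Z j i) * X i) (fun _ => 1)
  let F : MvPolynomial (Fin 3) K := aeval h g
  have hevalF : ∀ y, eval y F = eval (Sum.elim (Z.mulVec y) 1) g := by
    intro y
    rw [eval_aeval]
    congr 2
    funext x
    rcases x with j | j
    · simp [h, Matrix.mulVec, dotProduct]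
    · simp [h]
  have hscale : ∀ v q : Fin n → K,
      eval (Sum.elim (v * q) v) g = (∏ j, v j ^ c j) * eval (Sum.elim q 1) g := by
    intro v q
    rw [eval_eq', eval_eq', Finset.mul_sum]
    refine Finset.sum_congr rfl fun μ hμ => ?_
    simp only [Fintype.prod_sum_type, Sum.elim_inl, Sum.elim_inr, Pi.mul_apply, mul_pow,
      Finset.prod_mul_distrib, ← hc μ hμ, pow_add, Pi.one_apply, one_pow, Finset.prod_const_one]
    ring
  -- `q - Z A q` lies in the kernel of `A`, so the value at `(q, 1)` depends on `A q` alone.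
  have hproj : ∀ q : Fin n → K, eval (Sum.elim q 1) g = eval (A.mulVec q) F := by
    intro q
    rw [hevalF, ← hg (Z.mulVec (A.mulVec q)) 1 (q - Z.mulVec (A.mulVec q))]
    · congr 3
      funext j
      simp
    · rw [Matrix.mulVec_sub, Matrix.mulVec_mulVec _ A Z, hZ, Matrix.one_mulVec, sub_self]
  have hF0 : F ≠ 0 := by
    intro h0
    apply hg0
    refine funext_set (fun _ => ({0}ᶜ : Set K)) (fun _ => (Set.finite_singleton _).infinite_compl)
      fun x hx => ?_
    let v : Fin n → K := fun j => x (Sum.inr j)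
    let q : Fin n → K := fun j => x (Sum.inl j) / x (Sum.inr j)
    have hv : ∀ j, x (Sum.inr j) ≠ 0 := fun j => hx (Sum.inr j) (Set.mem_univ _)
    have hxe : x = Sum.elim (v * q) v := by
      funext y
      rcases y with j | j
      · simp only [Sum.elim_inl, Pi.mul_apply, v, q]
        field_simp [hv j]
      · rfl
    rw [hxe, hscale, hproj, h0, map_zero, map_zero, mul_zero]
  have hFd : F.IsHomogeneous d := by
    refine aeval_isWeightedHomogeneous hd fun x => ?_
    rcases x with j | j
    · exact IsHomogeneous.sum _ _ _ fun i _ => isHomogeneous_C_mul_X _ _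
    · exact isWeightedHomogeneous_one K _
  refine ⟨d, F, rfl, hF0, hFd, fun j e he => ?_⟩
  have her : e.degree + c j < d := by
    beta_reduce at he
    omega
  set T := aeval (fun i => X i + C (p j i) : Fin 3 → MvPolynomial (Fin 3) K) F with hT
  suffices hcomp : weightedHomogeneousComponent (1 : Fin 3 → ℕ) e.degree T = 0 by
    have := congrArg (coeff e) hcomp
    rw [coeff_weightedHomogeneousComponent, if_pos, coeff_zero] at this
    · exact this
    · rw [Finsupp.degree_eq_weight_one]
      rfl
  refine MvPolynomial.funext fun y => ?_
  rw [← coeff_aeval_C_mul_X_pow, map_zero]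
  set P : Polynomial K := aeval
    (fun i => Polynomial.C (y i) * Polynomial.X ^ (1 : Fin 3 → ℕ) i) T with hP
  let ev : Fin n → Polynomial K := fun l => if l = j then Polynomial.X else 1
  -- Take `vⱼ = T`, the other `v` equal to `1`, and `u/v = Z y + eⱼ/T`. Then `G(T) = T^(cⱼ) F(y +
  -- pⱼ/T)`, while `P(T) = F(pⱼ + T y) = T^d F(y + pⱼ/T)`. Since `G` is a polynomial, `P` has no
  -- terms of degree below `d - cⱼ`.
  let G : Polynomial K := aeval (Sum.elim
    (fun l => ev l * Polynomial.C (Z.mulVec y l) + if l = j then 1 else 0) ev) g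
  have hGP : Polynomial.X ^ d * G = Polynomial.X ^ c j * P := by
    refine Polynomial.eq_of_infinite_eval_eq _ _
      ((Set.finite_singleton (0 : K)).infinite_compl.mono ?_)
    intro s hs
    have hs : s ≠ 0 := hs
    let v : Fin n → K := fun l => if l = j then s else 1
    let q : Fin n → K := Z.mulVec y + Pi.single j s⁻¹
    have hG : Polynomial.eval s G = s ^ c j * eval (y + s⁻¹ • p j) F := by
      have h1 : Polynomial.eval s G = eval (Sum.elim (v * q) v) g := by
        rw [polynomial_eval_aeval]
        congr 2
        funext x
        rcases x with l | l
        · by_cases hl : l = j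
          · subst hl; simp [ev, v, q, mul_add, hs]; ring
          · simp [ev, v, q, hl]
        · by_cases hl : l = j <;> simp [ev, v, hl]
      have h2 : ∏ l, v l ^ c l = s ^ c j := by
        rw [Finset.prod_eq_single j]
        · simp [v]
        · intro l _ hl; simp [v, hl]
        · simp
      have h3 : A.mulVec q = y + s⁻¹ • p j := by
        rw [Matrix.mulVec_add, Matrix.mulVec_mulVec, hZ, Matrix.one_mulVec]
        congr 1
        funext i
        simp [hA, mul_comm]
      rw [h1, hscale, hproj, h2, h3]
    have hPs : Polynomial.eval s P = s ^ d * eval (y + s⁻¹ • p j) F := by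
      have h1 := aeval_pow_mul_of_isWeightedHomogeneous hFd s (y + s⁻¹ • p j)
      simp only [aeval_eq_eval] at h1
      rw [← h1, hP, polynomial_eval_aeval, hT, eval_aeval]
      congr 2
      funext i
      simp [mul_add, hs]
      ring
    simp only [Set.mem_ofPred_eq, Polynomial.eval_mul, Polynomial.eval_pow, Polynomial.eval_X]
    rw [hG, hPs]
    ring
  have hcoeff := congrArg (fun Q => Polynomial.coeff Q (e.degree + c j)) hGP
  simp only [Polynomial.coeff_X_pow_mul'] at hcoeff
  rw [if_neg (not_le.mpr her), if_pos (Nat.le_add_left _ _), Nat.add_sub_cancel] at hcoeff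
  exact hcoeff.symm

end Curves

/-! ### Invariants give effective classes -/

section Invariants

variable {F : Type*} [Field F] {n : ℕ} {m : Fin n → ℕ}

theorem prod_zpow_eq_zpow_sum {G ι : Type*} [CommGroup G] (s : G) (t : Finset ι) (z : ι → ℤ) :
    ∏ l ∈ t, s ^ z l = s ^ ∑ l ∈ t, z l := by
  classical
  induction t using Finset.induction_on with
  | empty => simp
  | insert l t hl ih => rw [Finset.prod_insert hl, Finset.sum_insert hl, ih, zpow_add]

/-- A variable of the generic field, as a unit. -/
def genericUnit (F : Type*) [Field F] {n : ℕ} (j : Fin n) : (GenericField F n)ˣ :=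
  Units.mk0 (algebraMap (MvPolynomial (Fin 3 × Fin n) F) (GenericField F n) (X (0, j)))
    (by simp)

/-- An indeterminate is not a root of unity, so its powers detect integer weights of the torus even
when `F` is finite. -/
theorem genericUnit_zpow_eq_one {j : Fin n} {N : ℤ} (h : genericUnit F j ^ N = 1) : N = 0 := by
  have key : ∀ N : ℕ, genericUnit F j ^ N = 1 → N = 0 := by
    intro N hN
    by_contra h0
    have h1 : algebraMap (MvPolynomial (Fin 3 × Fin n) F) (GenericField F n) (X (0, j) ^ N) =
        algebraMap (MvPolynomial (Fin 3 × Fin n) F) (GenericField F n) 1 := by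
      rw [map_pow, map_one]
      exact congrArg Units.val hN
    have h2 := IsFractionRing.injective (MvPolynomial (Fin 3 × Fin n) F) (GenericField F n) h1
    have h3 := congrArg (eval (fun _ => (0 : F))) h2
    simp [h0] at h3
  obtain ⟨k, rfl | rfl⟩ := N.eq_nat_or_neg
  · rw [key k (by simpa using h)]; rfl
  · rw [key k (by simpa using h)]; rfl

theorem infinite_genericField (F : Type*) [Field F] {n : ℕ} (j : Fin n) :
    Infinite (GenericField F n) := by
  refine Infinite.of_injective (fun N : ℤ => ((genericUnit F j ^ N : (GenericField F n)ˣ) :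
    GenericField F n)) fun N N' h => ?_
  have h1 : genericUnit F j ^ N = genericUnit F j ^ N' := Units.ext h
  have h2 : genericUnit F j ^ (N - N') = 1 := by rw [zpow_sub, h1, mul_inv_cancel]
  exact sub_eq_zero.mp (genericUnit_zpow_eq_one h2)

/-- The weight of a monomial of an invariant vanishes on the one-parameter subgroups of `H`. -/
theorem sum_mul_eq_zero_of_mem_support (j₀ : Fin n) {f : PolyUV F n} (hf : f ∈ invariantRing F m)
    {μ : Fin n ⊕ Fin n →₀ ℕ} (hμ : μ ∈ f.support) {z : Fin n → ℤ} (hz : ∑ i, z i * m i = 0) :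
    ∑ i, (z i - ∑ l, z l) * μ (Sum.inl i) + ∑ i, z i * μ (Sum.inr i) = 0 := by
  let s := genericUnit F j₀
  have hprod : ∏ l, s ^ z l = s ^ ∑ l, z l := prod_zpow_eq_zpow_sum _ _ _
  let c : Fin n → (GenericField F n)ˣ := fun i => s ^ z i
  have hc : c ∈ subgroupH F m := by
    change ∏ i, (s ^ z i) ^ m i = 1
    simp only [← zpow_natCast, ← zpow_mul]
    rw [prod_zpow_eq_zpow_sum, hz, zpow_zero]
  let χ : Fin n ⊕ Fin n → (GenericField F n)ˣ :=
    Sum.elim (fun i => s ^ (z i - ∑ l, z l)) (fun i => s ^ z i)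
  have hσ : sigma F c 0 =
      aeval (fun x => C ((χ x : (GenericField F n)ˣ) : GenericField F n) * X x) := by
    refine MvPolynomial.algHom_ext fun x => ?_
    rw [sigma, aeval_X, aeval_X]
    rcases x with i | i
    · have h1 : ((c i : GenericField F n) / ∏ j, (c j : GenericField F n)) =
          ((χ (Sum.inl i) : (GenericField F n)ˣ) : GenericField F n) := by
        rw [← Units.coe_prod, hprod, ← Units.val_div_eq_div_val]
        exact congrArg Units.val (zpow_sub s _ _).symm
      simp only [Sum.elim_inl, h1, Pi.zero_apply, C_0, zero_mul, add_zero]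
    · rfl
  have h1 := congrArg (coeff μ) (hf c hc 0 (zero_mem _))
  rw [hσ, coeff_aeval_C_mul_X] at h1
  have h2 := mul_right_cancel₀ (mem_support_iff.mp hμ) (h1.trans (one_mul _).symm)
  have h3 : ∏ x, χ x ^ μ x = 1 := by
    apply Units.ext
    push_cast
    exact h2
  rw [Fintype.prod_sum_type] at h3
  simp only [χ, Sum.elim_inl, Sum.elim_inr, ← zpow_natCast, ← zpow_mul] at h3
  rw [prod_zpow_eq_zpow_sum, prod_zpow_eq_zpow_sum, ← zpow_add] at h3
  exact genericUnit_zpow_eq_one h3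

/-- The multidegree of a monomial of an invariant is proportional to `m`. -/
theorem mul_eq_mul_of_mem_support (j₀ : Fin n) {f : PolyUV F n} (hf : f ∈ invariantRing F m)
    {μ : Fin n ⊕ Fin n →₀ ℕ} (hμ : μ ∈ f.support) (i : Fin n) :
    ((∑ l, m l : ℕ) : ℤ) *
        ((∑ l, μ (Sum.inl l) : ℕ) - (μ (Sum.inl i) + μ (Sum.inr i) : ℕ) : ℤ) =
      (n * (∑ l, μ (Sum.inl l) : ℕ) - (∑ l, μ (Sum.inl l) : ℕ) - (∑ l, μ (Sum.inr l) : ℕ) : ℤ) *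
        m i := by
  -- The cocharacter `M eᵢ - mᵢ (1, …, 1)`, with `M = ∑ mₗ`, is orthogonal to `m`.
  let z : Fin n → ℤ := fun l => (if l = i then ((∑ l, m l : ℕ) : ℤ) else 0) - m i
  have hz : ∑ l, z l * m l = 0 := by
    simp only [z, sub_mul, ite_mul, zero_mul, Finset.sum_sub_distrib, Finset.sum_ite_eq',
      Finset.mem_univ, if_true, ← Finset.mul_sum]
    push_cast
    ring
  have hZ : ∑ l, z l = ((∑ l, m l : ℕ) : ℤ) - n * m i := by
    simp [z, Finset.sum_sub_distrib]
  have h := sum_mul_eq_zero_of_mem_support j₀ hf hμ hz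
  rw [hZ] at h
  have h1 : ∑ l, (z l - (((∑ l, m l : ℕ) : ℤ) - n * m i)) * μ (Sum.inl l) =
      ((∑ l, m l : ℕ) : ℤ) * μ (Sum.inl i) -
        (m i + (((∑ l, m l : ℕ) : ℤ) - n * m i)) * ∑ l, (μ (Sum.inl l) : ℤ) := by
    simp only [z, sub_mul, ite_mul, zero_mul, Finset.sum_sub_distrib, Finset.sum_ite_eq',
      Finset.mem_univ, if_true, ← Finset.mul_sum]
    ring
  have h2 : ∑ l, z l * μ (Sum.inr l) =
      ((∑ l, m l : ℕ) : ℤ) * μ (Sum.inr i) - m i * ∑ l, (μ (Sum.inr l) : ℤ) := by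
    simp only [z, sub_mul, ite_mul, zero_mul, Finset.sum_sub_distrib, Finset.sum_ite_eq',
      Finset.mem_univ, if_true, ← Finset.mul_sum]
  rw [h1, h2] at h
  push_cast at h ⊢
  linear_combination -h

theorem translationInvariant_of_mem {f : PolyUV F n} (hf : f ∈ invariantRing F m) :
    TranslationInvariant (Matrix.of (genericPoints F n)).transpose f := by
  intro u v b hb
  have h1 := congrArg (eval (Sum.elim u v)) (hf 1 (one_mem _) b hb)
  rw [sigma, eval_aeval] at h1
  rw [← h1]
  congr 2
  funext x
  rcases x with i | i
  · simp [mul_comm]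
  · simp

/-- In the component of bidegree `(d, e)` in `u` and `v`, `mul_eq_mul_of_mem_support` fixes the
degree in each pair `uⱼ, vⱼ`, so `TranslationInvariant.effectiveClass` applies. -/
theorem effectiveClass_of_mem_support (j₀ : Fin n) (hm : ∀ i, 0 < m i)
    {Z : Matrix (Fin n) (Fin 3) (GenericField F n)}
    (hZ : (Matrix.of (genericPoints F n)).transpose * Z = 1)
    {f : PolyUV F n} (hf : f ∈ invariantRing F m) {μ : Fin n ⊕ Fin n →₀ ℕ}
    (hμ : μ ∈ f.support) :
    EffectiveClass (genericPoints F n) ((∑ l, μ (Sum.inl l) : ℕ) : ℤ)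
      (fun j => ((∑ l, μ (Sum.inl l) : ℕ) : ℤ) - ((μ (Sum.inl j) + μ (Sum.inr j) : ℕ) : ℤ)) := by
  have := infinite_genericField F j₀
  set d := ∑ l, μ (Sum.inl l) with hd
  set e := ∑ l, μ (Sum.inr l) with he
  let g := weightedHomogeneousComponent (vWeight n) e
    (weightedHomogeneousComponent (uWeight n) d f)
  have hcoeff : ∀ ν, coeff ν g ≠ 0 →
      coeff ν f ≠ 0 ∧ ∑ l, ν (Sum.inl l) = d ∧ ∑ l, ν (Sum.inr l) = e := by
    intro ν hν
    simp only [g, coeff_weightedHomogeneousComponent, weight_uWeight, weight_vWeight] at hν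
    split_ifs at hν with h1 h2
    · exact ⟨hν, h2, h1⟩
    · exact absurd rfl hν
    · exact absurd rfl hν
  have hg0 : g ≠ 0 := by
    intro h0
    have h1 : coeff μ g = coeff μ f := by
      simp only [g, coeff_weightedHomogeneousComponent, weight_uWeight, weight_vWeight]
      rw [if_pos he.symm, if_pos hd.symm]
    rw [h0, coeff_zero] at h1
    exact mem_support_iff.mp hμ h1.symm
  refine TranslationInvariant.effectiveClass hZ
    ((translationInvariant_of_mem hf).uComponent d |>.vComponent e) hg0 (fun ν hν => ?_)
    fun ν hν j => ?_
  · rw [weight_uWeight]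
    exact (hcoeff ν hν).2.1
  · obtain ⟨h1, h2, h3⟩ := hcoeff ν (mem_support_iff.mp hν)
    have h4 := mul_eq_mul_of_mem_support j₀ hf (mem_support_iff.mpr h1) j
    have h5 := mul_eq_mul_of_mem_support j₀ hf hμ j
    rw [h2, h3, ← h5, ← hd] at h4
    have hM : ((∑ l, m l : ℕ) : ℤ) ≠ 0 := by
      have : 0 < ∑ l, m l := Finset.sum_pos (fun i _ => hm i) ⟨j₀, Finset.mem_univ _⟩
      exact_mod_cast this.ne'
    have h6 := mul_left_cancel₀ hM h4
    omega

end Invariants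

/-! ### Plane curves give invariants -/

section Converse

variable {F : Type*} [Field F] {n : ℕ} {m : Fin n → ℕ}

/-- The invariants `∑ⱼ x_{ij} uⱼ ∏_{l ≠ j} v_l`. -/
def invariantY (F : Type*) [Field F] (n : ℕ) (i : Fin 3) : PolyUV F n :=
  ∑ j, C (genericPoints F n j i) * (X (Sum.inl j) * ∏ l ∈ Finset.univ.erase j, X (Sum.inr l))

/-- The scalar `cⱼ/c` cancels against the product of the other `cₗ`, and the translation contributes
`∑ⱼ x_{ij} bⱼ = 0` times `∏ vₗ`. -/
theorem sigma_invariantY (c : Fin n → (GenericField F n)ˣ) {b : Fin n → GenericField F n}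
    (hb : b ∈ subspaceV F n) (i : Fin 3) :
    sigma F c b (invariantY F n i) = invariantY F n i := by
  have hterm : ∀ j, sigma F c b (C (genericPoints F n j i) *
      (X (Sum.inl j) * ∏ l ∈ Finset.univ.erase j, X (Sum.inr l))) =
      C (genericPoints F n j i) * (X (Sum.inl j) * ∏ l ∈ Finset.univ.erase j, X (Sum.inr l)) +
        C (genericPoints F n j i * b j) * ∏ l, X (Sum.inr l) := by
    intro j
    have hc : ((c j : GenericField F n) / ∏ l, (c l : GenericField F n)) *
        ∏ l ∈ Finset.univ.erase j, (c l : GenericField F n) = 1 := by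
      rw [div_mul_eq_mul_div, Finset.mul_prod_erase _ (fun l => (c l : GenericField F n))
        (Finset.mem_univ j), div_self]
      exact Finset.prod_ne_zero_iff.mpr fun l _ => (c l).ne_zero
    have hC := congrArg (C : GenericField F n → PolyUV F n) hc
    rw [C_mul, C_1, map_prod] at hC
    simp only [sigma, map_mul, map_prod, aeval_X, aeval_C, algebraMap_eq, Sum.elim_inl,
      Sum.elim_inr, Finset.prod_mul_distrib]
    rw [← Finset.mul_prod_erase Finset.univ (fun l => (X (Sum.inr l) : PolyUV F n))
      (Finset.mem_univ j)]
    linear_combination (C (genericPoints F n j i) * (X (Sum.inl j) + C (b j) * X (Sum.inr j)) *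
      ∏ l ∈ Finset.univ.erase j, X (Sum.inr l)) * hC
  have hsum : ∑ j, genericPoints F n j i * b j = 0 := congrFun hb i
  rw [invariantY, map_sum, Finset.sum_congr rfl fun j _ => hterm j, Finset.sum_add_distrib,
    ← Finset.sum_mul, ← map_sum, hsum, C_0, zero_mul, add_zero]

/-- Every summand of `Yᵢ` except the `j`-th contains `vⱼ`, so modulo `vⱼ` the vector `Y` is a
multiple of the point `xⱼ`, where the form vanishes to order `r`. -/
theorem X_pow_dvd_aeval_invariantY {f : MvPolynomial (Fin 3) (GenericField F n)} {e r : ℕ}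
    (hf : f.IsHomogeneous e) {j : Fin n} (hr : HasMultAtLeast f (genericPoints F n j) r) :
    (X (Sum.inr j) : PolyUV F n) ^ r ∣ aeval (invariantY F n) f := by
  let w : PolyUV F n := X (Sum.inl j) * ∏ l ∈ Finset.univ.erase j, X (Sum.inr l)
  have hw : w ≠ 0 := mul_ne_zero (X_ne_zero _) (Finset.prod_ne_zero_iff.mpr fun l _ => X_ne_zero _)
  let z : Fin 3 → PolyUV F n := fun i => ∑ j' ∈ Finset.univ.erase j, C (genericPoints F n j' i) *
    (X (Sum.inl j') * ∏ l ∈ Finset.univ.erase j', X (Sum.inr l))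
  have hz : ∀ i, z i ∈ Ideal.span {(X (Sum.inr j) : PolyUV F n)} := by
    refine fun i => sum_mem fun j' hj' => Ideal.mul_mem_left _ _ (Ideal.mul_mem_left _ _ ?_)
    rw [Ideal.mem_span_singleton]
    exact Finset.dvd_prod_of_mem (fun l => (X (Sum.inr l) : PolyUV F n))
      (Finset.mem_erase.mpr ⟨(Finset.ne_of_mem_erase hj').symm, Finset.mem_univ j⟩)
  have hY : ∀ i, genericPoints F n j i • w + z i = invariantY F n i := by
    intro i
    rw [smul_eq_C_mul, invariantY, ← Finset.add_sum_erase _ _ (Finset.mem_univ j)]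
  have hmem := aeval_smul_add_mem_pow hf (genericPoints F n j) hw z hz (r := r)
    fun s hs => Or.inl (hr s hs)
  rw [Ideal.span_singleton_pow, Ideal.mem_span_singleton] at hmem
  simpa only [hY] using hmem

/-- The substitution `u = Z X`, `v = 1` sends `Yᵢ` back to `Xᵢ`. -/
theorem aeval_invariantY_ne_zero {Z : Matrix (Fin n) (Fin 3) (GenericField F n)}
    (hZ : (Matrix.of (genericPoints F n)).transpose * Z = 1)
    {f : MvPolynomial (Fin 3) (GenericField F n)} (hf : f ≠ 0) : aeval (invariantY F n) f ≠ 0 := by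
  intro h0
  let φ : PolyUV F n →ₐ[GenericField F n] MvPolynomial (Fin 3) (GenericField F n) :=
    aeval (Sum.elim (fun j => ∑ i, C (Z j i) * X i) (fun _ => 1))
  have hφ : ∀ i, φ (invariantY F n i) = X i := by
    intro i
    have hZi : ∀ i', ∑ j, genericPoints F n j i * Z j i' = if i = i' then 1 else 0 := by
      intro i'
      have := congrFun (congrFun hZ i) i'
      rwa [Matrix.mul_apply, Matrix.one_apply] at this
    simp only [φ, invariantY, map_sum, map_mul, map_prod, aeval_X, aeval_C, algebraMap_eq,
      Sum.elim_inl, Sum.elim_inr, Finset.prod_const_one, mul_one, Finset.mul_sum]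
    rw [Finset.sum_comm]
    simp only [← mul_assoc, ← Finset.sum_mul, ← C_mul, ← map_sum, hZi]
    simp
  apply hf
  have h1 := congrArg φ h0
  rw [← AlgHom.comp_apply, comp_aeval, map_zero] at h1
  simpa only [hφ, aeval_X_left, AlgHom.id_apply] using h1

/-- A curve with multiplicities at least `t m` at the generic points gives an invariant. -/
theorem exists_mem_invariantRing {e t : ℕ}
    (h : EffectiveClass (genericPoints F n) e (fun j => ((t * m j : ℕ) : ℤ))) :
    ∃ (f : MvPolynomial (Fin 3) (GenericField F n)) (q : PolyUV F n), f ≠ 0 ∧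
      f.IsHomogeneous e ∧ q ∈ invariantRing F m ∧ aeval (invariantY F n) f =
        (∏ j, X (Sum.inr j) ^ (t * m j)) * q := by
  obtain ⟨e', f, he, hf0, hf, hmult⟩ := h
  obtain rfl : e' = e := by exact_mod_cast he
  have hdvd : ∏ j, (X (Sum.inr j) : PolyUV F n) ^ (t * m j) ∣ aeval (invariantY F n) f := by
    refine Finset.prod_dvd_of_isRelPrime (fun i _ j _ hij => ?_)
      fun j _ => X_pow_dvd_aeval_invariantY hf (hmult j)
    refine IsRelPrime.pow ?_
    refine (Irreducible.isRelPrime_iff_not_dvd (X_prime (i := _)).irreducible).mpr ?_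
    rw [X_dvd_X]
    exact fun h => hij (Sum.inr_injective h)
  obtain ⟨q, hq⟩ := hdvd
  refine ⟨f, q, hf0, hf, fun c hc b hb => ?_, hq⟩
  -- The exponents are proportional to `m`, so the defining equation of `H` fixes this monomial; the
  -- quotient is then fixed as well.
  have hV : sigma F c b (∏ j, X (Sum.inr j) ^ (t * m j)) = ∏ j, X (Sum.inr j) ^ (t * m j) := by
    have hc1 : ∏ j, (c j : GenericField F n) ^ (t * m j) = 1 := by
      have h1 : ∏ i, c i ^ m i = 1 := hc
      have h2 := congrArg (fun x : (GenericField F n)ˣ => ((x ^ t : _) : GenericField F n)) h1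
      simpa [← Finset.prod_pow, ← pow_mul, mul_comm] using h2
    simp only [sigma, map_prod, map_pow, aeval_X, Sum.elim_inr, mul_pow, Finset.prod_mul_distrib]
    simp only [← C_pow, ← map_prod]
    rw [hc1, C_1, one_mul]
  have hY : sigma F c b (aeval (invariantY F n) f) = aeval (invariantY F n) f := by
    rw [← AlgHom.comp_apply, comp_aeval]
    simp only [sigma_invariantY c hb]
  rw [hq, map_mul, hV] at hY
  exact mul_left_cancel₀ (Finset.prod_ne_zero_iff.mpr fun j _ => pow_ne_zero _ (X_ne_zero _)) hY

end Converse

/-! ### Infinite generation -/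

section Main

/-- The polynomials all of whose monomials have nonnegative weight. -/
def nonnegWeight {σ : Type*} (R : Type*) [CommSemiring R] (w : σ → ℝ) :
    Subalgebra R (MvPolynomial σ R) where
  carrier := {f | ∀ μ, coeff μ f ≠ 0 → 0 ≤ Finsupp.weight w μ}
  mul_mem' := by
    classical
    intro f g hf hg μ hμ
    obtain ⟨a, ha, b, hb, rfl⟩ :=
      Finset.mem_add.mp (support_mul f g (mem_support_iff.mpr hμ))
    rw [map_add]
    exact add_nonneg (hf a (mem_support_iff.mp ha)) (hg b (mem_support_iff.mp hb))
  add_mem' := by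
    intro f g hf hg μ hμ
    by_cases h : coeff μ f = 0
    · refine hg μ fun h' => hμ ?_
      rw [coeff_add, h, h', add_zero]
    · exact hf μ h
  algebraMap_mem' := by
    classical
    intro r μ hμ
    rw [algebraMap_eq, coeff_C] at hμ
    by_cases h : 0 = μ
    · rw [← h, map_zero]
    · exact absurd (if_neg h) hμ

/-- The weight on `k[u, v]` whose value is `d - θ t` on invariants of degree `(d; t m)`. -/
def slopeWeight {n : ℕ} (m : Fin n → ℕ) (θ : ℝ) : Fin n ⊕ Fin n → ℝ :=
  Sum.elim (fun _ => 1 + θ * (1 - n) / (∑ l, m l : ℕ)) (fun _ => θ / (∑ l, m l : ℕ))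

variable {n : ℕ} {m : Fin n → ℕ}

theorem weight_slopeWeight (θ : ℝ) (μ : Fin n ⊕ Fin n →₀ ℕ) :
    Finsupp.weight (slopeWeight m θ) μ = (∑ l, μ (Sum.inl l) : ℕ) -
      θ * (n * (∑ l, μ (Sum.inl l) : ℕ) - (∑ l, μ (Sum.inl l) : ℕ) - (∑ l, μ (Sum.inr l) : ℕ)) /
        (∑ l, m l : ℕ) := by
  simp only [Finsupp.weight_eq_sum, Fintype.sum_sum_type, slopeWeight, Sum.elim_inl, Sum.elim_inr,
    nsmul_eq_mul, ← Finset.sum_mul]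
  push_cast
  ring

theorem invariantY_isWeightedHomogeneous (F : Type*) [Field F] (θ : ℝ) (i : Fin 3) :
    IsWeightedHomogeneous (slopeWeight m θ) (invariantY F n i) 1 := by
  refine IsWeightedHomogeneous.sum _ _ _ fun j _ => IsWeightedHomogeneous.C_mul ?_ _
  have h1 := (isWeightedHomogeneous_X (GenericField F n) (slopeWeight m θ) (Sum.inl j)).mul
    (IsWeightedHomogeneous.prod (Finset.univ.erase j) _ _ fun l _ =>
      isWeightedHomogeneous_X (GenericField F n) (slopeWeight m θ) (Sum.inr l))
  convert h1 using 1
  have hn : 1 ≤ n := j.pos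
  simp only [slopeWeight, Sum.elim_inl, Sum.elim_inr, Finset.sum_const, nsmul_eq_mul,
    Finset.card_erase_of_mem (Finset.mem_univ j), Finset.card_univ, Fintype.card_fin]
  push_cast [hn]
  ring

theorem not_finiteType_invariantRing (hm : ∀ i, 0 < m i) {F : Type*} [Field F]
    (h : IsGoodRay (genericPoints F n) (ray (deltaClass m)) ∨
      IsWonderfulRay (genericPoints F n) (ray (deltaClass m))) :
    ¬ Algebra.FiniteType (GenericField F n) (invariantRing F m) := by
  intro hft
  -- For `n = 0` the class `(δ; m)` is zero and generates no ray.
  obtain ⟨j₀⟩ : Nonempty (Fin n) := by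
    by_contra hn
    rw [not_nonempty_iff] at hn
    have hray : IsRay (ray (deltaClass m)) := h.elim And.left And.left
    obtain ⟨ξ, hξ, hρ⟩ := hray
    obtain ⟨t, -, ht⟩ : ξ ∈ ray (deltaClass m) := hρ ▸ ⟨1, one_pos, by rw [one_smul]⟩
    apply hξ
    rw [ht]
    refine Prod.ext ?_ (funext fun i => isEmptyElim i)
    simp [deltaClass]
  set M := ∑ l, m l with hM
  have hMpos : 0 < M := Finset.sum_pos (fun i _ => hm i) ⟨j₀, Finset.mem_univ _⟩
  have hMR : (0 : ℝ) < M := by exact_mod_cast hMpos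
  have hline := not_good_or_wonderful_of_line hm h
  obtain ⟨Z, hZ⟩ : ∃ Z : Matrix (Fin n) (Fin 3) (GenericField F n),
      (Matrix.of (genericPoints F n)).transpose * Z = 1 := by
    have hinj : LinearMap.ker (Matrix.of (genericPoints F n)).mulVecLin = ⊥ := by
      rw [LinearMap.ker_eq_bot']
      intro ℓ hℓ
      by_contra h0
      refine hline (effectiveClass_of_vecMul_eq_zero h0 fun j => ?_)
      have h1 : ∑ i, genericPoints F n j i * ℓ i = 0 := congrFun hℓ j
      simpa only [mul_comm] using h1
    obtain ⟨g, hg⟩ := LinearMap.exists_leftInverse_of_injective _ hinj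
    refine ⟨(LinearMap.toMatrix' g).transpose, ?_⟩
    rw [← Matrix.transpose_mul]
    have h1 := congrArg LinearMap.toMatrix' hg
    rw [LinearMap.toMatrix'_comp, ← Matrix.toLin'_apply', LinearMap.toMatrix'_toLin',
      LinearMap.toMatrix'_id] at h1
    rw [h1, Matrix.transpose_one]
  obtain ⟨S, hS⟩ := (Subalgebra.fg_iff_finiteType _).mpr hft
  -- Here `A = M t`. Monomials with `A ≤ 0` allow every `θ > δ`; for the others `δ A < M d` is
  -- strict and persists for `θ` slightly above `δ`.
  obtain ⟨θ, hθ, hSθ⟩ : ∃ θ : ℝ, (deltaClass m).1 < θ ∧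
      ∀ f ∈ S, ∀ μ ∈ f.support, 0 ≤ Finsupp.weight (slopeWeight m θ) μ := by
    have hev : ∀ᶠ θ in nhdsWithin (deltaClass m).1 (Set.Ioi (deltaClass m).1),
        ∀ f ∈ S, ∀ μ ∈ f.support, 0 ≤ Finsupp.weight (slopeWeight m θ) μ := by
      rw [Filter.eventually_all_finset]
      intro f hfS
      rw [Filter.eventually_all_finset]
      intro μ hμ
      have hf : f ∈ invariantRing F m := hS ▸ Algebra.subset_adjoin hfS
      set d := ∑ l, μ (Sum.inl l) with hd
      set A : ℤ := n * (d : ℤ) - d - (∑ l, μ (Sum.inr l) : ℕ) with hA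
      have hweight : ∀ θ : ℝ, Finsupp.weight (slopeWeight m θ) μ = d - θ * A / M := by
        intro θ
        rw [weight_slopeWeight, hA, ← hd, ← hM]
        push_cast
        rfl
      rcases le_or_gt A 0 with hA0 | hA0
      · filter_upwards [self_mem_nhdsWithin] with θ hθ
        have hθ0 : 0 ≤ θ := (Real.sqrt_nonneg _).trans (le_of_lt hθ)
        have hA0 : (A : ℝ) ≤ 0 := by exact_mod_cast hA0
        rw [hweight, sub_nonneg]
        exact (div_nonpos_of_nonpos_of_nonneg (mul_nonpos_of_nonneg_of_nonpos hθ0 hA0)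
          hMR.le).trans (by positivity)
      · obtain ⟨A', hA'⟩ := Int.eq_ofNat_of_zero_le hA0.le
        have heff := effectiveClass_of_mem_support j₀ hm hZ hf hμ
        have hlt := delta_mul_lt_of_effectiveClass hm h heff hMpos (A := A')
          (by rw [hA'] at hA0; exact_mod_cast hA0)
          fun j => by rw [← hA']; exact mul_eq_mul_of_mem_support j₀ hf hμ j
        have hlt : (deltaClass m).1 * A < M * d := by
          rw [hA']
          exact_mod_cast hlt
        have hcont : Filter.Tendsto (fun θ : ℝ => θ * A)
            (nhdsWithin (deltaClass m).1 (Set.Ioi (deltaClass m).1))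
            (nhds ((deltaClass m).1 * A)) :=
          (Continuous.tendsto (by fun_prop) _).mono_left nhdsWithin_le_nhds
        filter_upwards [hcont.eventually_lt_const hlt] with θ hθ
        rw [hweight, sub_nonneg, div_le_iff₀ hMR]
        linarith
    obtain ⟨θ, hθ1, hθ2⟩ := (hev.and self_mem_nhdsWithin).exists
    exact ⟨θ, hθ2, hθ1⟩
  have hle : invariantRing F m ≤ nonnegWeight (GenericField F n) (slopeWeight m θ) := by
    rw [← hS]
    exact Algebra.adjoin_le fun f hf μ hμ => hSθ f hf μ (mem_support_iff.mpr hμ)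
  have hp : ∀ j, genericPoints F n j 0 ≠ 0 := fun j => (genericUnit F j).ne_zero
  obtain ⟨t, e, -, het, heff⟩ := exists_effectiveClass_lt hp m hθ
  obtain ⟨f, q, hf0, hf, hq, hfq⟩ := exists_mem_invariantRing heff
  have hY0 := aeval_invariantY_ne_zero hZ hf0
  have hq0 : q ≠ 0 := by
    rintro rfl
    exact hY0 (by rw [hfq, mul_zero])
  obtain ⟨μ, hμ⟩ := ne_zero_iff.mp hq0
  let s : Fin n ⊕ Fin n →₀ ℕ := Finsupp.equivFunOnFinite.symm (Sum.elim 0 fun j => t * m j)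
  have hs : ∏ j, (X (Sum.inr j) : PolyUV F n) ^ (t * m j) = monomial s 1 := by
    rw [monomial_eq, Finsupp.prod_fintype _ _ (fun _ => pow_zero _), Fintype.prod_sum_type]
    simp [s]
  have hfR : IsWeightedHomogeneous (fun _ : Fin 3 => (1 : ℝ)) f e := by
    intro ν hν
    rw [Finsupp.weight_eq_sum, ← hf hν, Finsupp.weight_eq_sum]
    simp
  have hhom := aeval_isWeightedHomogeneous hfR fun i =>
    invariantY_isWeightedHomogeneous (m := m) F θ i
  have hcoeff : coeff (s + μ) (aeval (invariantY F n) f) ≠ 0 := by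
    rwa [hfq, hs, coeff_monomial_mul, one_mul]
  have hw := hhom hcoeff
  have hws : Finsupp.weight (slopeWeight m θ) s = θ * t := by
    rw [weight_slopeWeight]
    simp only [s, Finsupp.equivFunOnFinite_symm_apply_apply, Sum.elim_inl, Sum.elim_inr,
      Pi.zero_apply, Finset.sum_const_zero, ← Finset.mul_sum]
    rw [← hM]
    push_cast
    field_simp
    ring
  -- Each `Yᵢ` has weight `1`, so `s + μ` has weight `e`; hence `μ` has weight `e - θ t < 0`.
  rw [map_add, hws] at hw
  have := hle hq μ hμ
  linarith

end Main

end NagataRays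

end

open NagataRays in
theorem mainTheorem2 {n : ℕ} (m : Fin n → ℕ) (hm : ∀ i, 0 < m i) :
    (∀ (F : Type*) [Field F],
      (IsGoodRay (genericPoints F n) (ray (deltaClass m)) ∨
        IsWonderfulRay (genericPoints F n) (ray (deltaClass m))) →
      ¬ Algebra.FiniteType (GenericField F n) (invariantRing F m)) ∧
    (ForVeryGeneral n (fun p =>
        IsGoodRay p (ray (deltaClass m)) ∨ IsWonderfulRay p (ray (deltaClass m))) →
      ¬ Algebra.FiniteType (GenericField ℂ n) (invariantRing ℂ m)) :=
  ⟨fun _ _ h => not_finiteType_invariantRing hm h,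
    fun h => not_finiteType_invariantRing hm h.generic⟩
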